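/- Let $d\ge 1$ and let $(A_0,A_1,\dots)$ be an $\mathbb{R}^d$-valued process on a probability space which is centered ($E(A_\ell)=0$ for all $\ell$) and bounded in $L^p$ for some $p\in(2,\infty]$, i.e. $\sup_\ell \|A_\ell\|_{L^p}<\infty$. Assume that it satisfies the following condition (H): there exist $\epsilon_0>0$ and $C,c>0$ such that, for all integers $n,m,k>0$, all integers $0\le b_1<b_2<\dots<b_{n+m+1}$ and all $t_1,\dots,t_{n+m}\in\mathbb{R}^d$ with $|t_j|\le\epsilon_0$, setting $$S=\sum_{j=1}^{n}\Big\langle t_j,\sum_{\ell=b_j}^{b_{j+1}-1}A_\ell\Big\rangle,\qquad S'=\sum_{j=n+1}^{n+m}\Big\langle t_j,\sum_{\ell=b_j+k}^{b_{j+1}+k-1}A_\ell\Big\rangle,$$ one has $$\Big|E\big(e^{iS+iS'}\big)-E\big(e^{iS}\big)\,E\big(e^{iS'}\big)\Big|\le C\Big(1+\max_{1\le j\le n+m}|b_{j+1}-b_j|\Big)^{C(n+m)}e^{-ck}.$$ Then for every exponent $q$ with $0<q<p$ (that is, $q=p-\eta$ with $0<\eta<p$ when $p<\infty$, and any finite $q>0$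 when $p=\infty$) there exists $C>0$ such that, for all integers $m,n\ge 0$, $$\Big\|\sum_{\ell=m}^{m+n-1}A_\ell\Big\|_{L^{q}}\le C\,n^{1/2}.$$ Here $\|X\|_{L^q}=(E|X|^q)^{1/q}$, where $|\cdot|$ is the Euclidean norm. -/

import Mathlib

open MeasureTheory
open scoped ENNReal NNReal

/-- The process `A` is bounded in `L^p`: every `A ℓ` is in `L^p`, with norms bounded uniformly
in `ℓ`. -/
def BoundedInLp {Ω : Type*} [MeasurableSpace Ω] {d : ℕ} (μ : Measure Ω)
    (A : ℕ → Ω → EuclideanSpace ℝ (Fin d)) (p : ℝ≥0∞) : Prop :=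
  ∃ K : ℝ≥0, ∀ ℓ, MemLp (A ℓ) p μ ∧ eLpNorm (A ℓ) p μ ≤ K

/-- The process `A` is centered: every `A ℓ` is integrable with zero expectation. -/
def IsCenteredProcess {Ω : Type*} [MeasurableSpace Ω] {d : ℕ} (μ : Measure Ω)
    (A : ℕ → Ω → EuclideanSpace ℝ (Fin d)) : Prop :=
  ∀ ℓ, Integrable (A ℓ) μ ∧ ∫ ω, A ℓ ω ∂μ = 0

/-- The real random variable `∑_{j ∈ s} ⟨t_j, ∑_{ℓ = b_j + k}^{b_{j+1} + k - 1} A_ℓ⟩`, where the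
`j`-th block is `[b_j, b_{j+1})` and all the blocks are shifted to the right by `k`. -/
noncomputable def blockPhase {Ω : Type*} {d : ℕ} (A : ℕ → Ω → EuclideanSpace ℝ (Fin d))
    (b : ℕ → ℕ) (t : ℕ → EuclideanSpace ℝ (Fin d)) (s : Finset ℕ) (k : ℕ) (ω : Ω) : ℝ :=
  ∑ j ∈ s, inner ℝ (t j) (∑ ℓ ∈ Finset.Ico (b j + k) (b (j + 1) + k), A ℓ ω)

/-- Condition (H): a gap of size `k` between the first `n` blocks and the last `m` blocks makes
the characteristic function of the `n + m` block sums exponentially close to a product.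
The blocks are numbered from `0`, so that block `j` is `[b j, b (j + 1))` for `j < n + m`; only
the values `b 0 < b 1 < ⋯ < b (n + m)` and `t 0, …, t (n + m - 1)` play a role. The differences
`b (j + 1) - b j` are positive, so that no truncation occurs. -/
def ConditionH {Ω : Type*} [MeasurableSpace Ω] {d : ℕ} (μ : Measure Ω)
    (A : ℕ → Ω → EuclideanSpace ℝ (Fin d)) : Prop :=
  ∃ ε₀ C c : ℝ, 0 < ε₀ ∧ 0 < C ∧ 0 < c ∧
    ∀ n m k : ℕ, 0 < n → 0 < m → 0 < k →
    ∀ b : ℕ → ℕ, (∀ j < n + m, b j < b (j + 1)) →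
    ∀ t : ℕ → EuclideanSpace ℝ (Fin d), (∀ j < n + m, ‖t j‖ ≤ ε₀) →
      ‖(∫ ω, Complex.exp (Complex.I * ((blockPhase A b t (Finset.range n) 0 ω
            + blockPhase A b t (Finset.Ico n (n + m)) k ω : ℝ) : ℂ)) ∂μ)
          - (∫ ω, Complex.exp
              (Complex.I * ((blockPhase A b t (Finset.range n) 0 ω : ℝ) : ℂ)) ∂μ)
            * (∫ ω, Complex.exp
              (Complex.I * ((blockPhase A b t (Finset.Ico n (n + m)) k ω : ℝ) : ℂ)) ∂μ)‖
        ≤ C * (1 + (((Finset.range (n + m)).sup (fun j => b (j + 1) - b j) : ℕ) : ℝ))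
              ^ (C * ((n : ℝ) + (m : ℝ)))
            * Real.exp (-(c * (k : ℝ)))

/-! It suffices to bound each coordinate, for real exponents `2 < q < p`. The bound is proved by
induction on the length `N` of a block. The block is cut into two halves `X` and `Y` of length at
most `N / 2`, separated by a gap of length `k ≈ √N`. By the triangle inequality the gap costs only
`O(√N)` in `L^q`. If the halves were independent up to lower order terms, then `E|X + Y|^q` would be
at most `2 (1/√2)^q (D √N)^q` plus cross terms, and `2 (1/√2)^q < 1` because `q > 2`; a large `D`
absorbs the rest.

The cross terms are `E|X|^(q-1)|Y|` and its mirror image. If they almost factor, they are of order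
`(D √N)^(q-1) √N`, one power of `D` below the main term. For this the bound `E|Y| ≤ B √N` must not
involve `D`; it comes from exponential decay of correlations (`exists_abs_integral_mul_le`,
`exists_integral_sq_blockSum_le`).

Condition (H) controls characteristic functions at small frequencies only, so it gives factorization
for trigonometric polynomials, not for powers. The bridge is `dyadicSin`: the sum of `2^(iα)
sin(x/2^i)^(2j)` has bounded frequencies and is comparable to `|x|^α` up to the cutoff `2^L`. Taking
`2^L ≈ exp(δk)`, the decorrelation error stays small, and the part beyond the cutoff is controlled
by the `p`-th moment, which grows only polynomially in `N` (`exists_integral_rpow_mul_le`). The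
induction is `IsDecorrelatedProcess.exists_eLpNorm_blockSum_le`. -/

/-! ### Powers compared with dyadic sums of sines. -/

theorem sum_min_div_two_pow_le_two_mul (L : ℕ) :
    ∀ y : ℝ, 0 < y → y ≤ 1 →
      ∑ i ∈ Finset.range L, min (y / 2 ^ i) (2 ^ i / y) ≤ 2 * y := by
  induction L with
  | zero => intro y hy _; simp; exact hy.le
  | succ L ih =>
    intro y hy hy1
    rw [Finset.sum_range_succ']
    have h := ih (y / 2) (by positivity) (by linarith)
    have e : ∀ i : ℕ, min (y / 2 ^ (i + 1)) (2 ^ (i + 1) / y)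
        = min (y / 2 / 2 ^ i) (2 ^ i / (y / 2)) := by
      intro i
      congr 1 <;> · rw [pow_succ]; field_simp
    simp only [e]
    have h2 : min (y / 2 ^ 0) (2 ^ 0 / y) ≤ y := (min_le_left _ _).trans (by simp)
    linarith

/-- Removing the first term replaces `y` by `y / 2`. The correction `-2 / y` makes the bound stable
under this induction until `y` drops below `2`, where the previous lemma takes over. -/
theorem sum_min_div_two_pow_le_four_sub (L : ℕ) :
    ∀ y : ℝ, 1 ≤ y →
      ∑ i ∈ Finset.range L, min (y / 2 ^ i) (2 ^ i / y) ≤ 4 - 2 / y := by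
  induction L with
  | zero =>
    intro y hy
    have : 2 / y ≤ 2 := by rw [div_le_iff₀ (by linarith)]; linarith
    simp only [Finset.range_zero, Finset.sum_empty]; linarith
  | succ L ih =>
    intro y hy
    have hy0 : 0 < y := by linarith
    rw [Finset.sum_range_succ']
    have e : ∀ i : ℕ, min (y / 2 ^ (i + 1)) (2 ^ (i + 1) / y)
        = min (y / 2 / 2 ^ i) (2 ^ i / (y / 2)) := by
      intro i
      congr 1 <;> · rw [pow_succ]; field_simp
    simp only [e]
    have h2 : min (y / 2 ^ 0) (2 ^ 0 / y) ≤ 1 / y := (min_le_right _ _).trans (by simp)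
    rcases le_total 2 y with h | h
    · have := ih (y / 2) (by linarith)
      have e2 : 2 / (y / 2) = 4 * (1 / y) := by field_simp; norm_num
      have e3 : 2 / y = 2 * (1 / y) := by ring
      have : 0 < 1 / y := by positivity
      linarith
    · have := sum_min_div_two_pow_le_two_mul L (y / 2) (by linarith) (by linarith)
      have key : 1 / y + y ≤ 4 - 2 / y := by
        have : 4 - 2 / y - (1 / y + y) = (y - 1) * (3 - y) / y := by field_simp; ring
        have h3 : 0 ≤ (y - 1) * (3 - y) / y :=
          div_nonneg (mul_nonneg (by linarith) (by linarith)) hy0.le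
        linarith
      linarith

theorem sum_min_div_two_pow_le_four (L : ℕ) {y : ℝ} (hy : 0 < y) :
    ∑ i ∈ Finset.range L, min (y / 2 ^ i) (2 ^ i / y) ≤ 4 := by
  rcases le_total y 1 with h | h
  · linarith [sum_min_div_two_pow_le_two_mul L y hy h]
  · have : 0 < 2 / y := by positivity
    linarith [sum_min_div_two_pow_le_four_sub L y h]

/-- A dyadic sum of powers of sines, comparable to `|x| ^ α` for `1 ≤ |x| < 2 ^ L`. -/
noncomputable def dyadicSin (α : ℝ) (j L : ℕ) (x : ℝ) : ℝ :=
  ∑ i ∈ Finset.range (L + 1), (2 ^ i : ℝ) ^ α * Real.sin (x / 2 ^ i) ^ (2 * j)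

theorem dyadicSin_nonneg (α : ℝ) (j L : ℕ) (x : ℝ) : 0 ≤ dyadicSin α j L x := by
  refine Finset.sum_nonneg fun i _ => mul_nonneg (by positivity) ?_
  rw [pow_mul]; positivity

/-- The factor `min u (1 / u)` makes the sum over dyadic scales converge on both sides: for small
`u` it comes from `2 * j` exceeding `α` by one, for large `u` from `1 ≤ α`. -/
theorem sin_pow_le_rpow_mul_min {α u : ℝ} {j : ℕ} (hα : 1 ≤ α) (hj : α + 1 ≤ 2 * j)
    (hu : 0 < u) : |Real.sin u| ^ (2 * j) ≤ u ^ α * min u (1 / u) := by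
  have h1 : |Real.sin u| ≤ 1 := Real.abs_sin_le_one u
  have h2 : |Real.sin u| ≤ u := by simpa [abs_of_pos hu] using Real.abs_sin_le_abs (x := u)
  rcases le_total u 1 with h | h
  · rw [min_eq_left (h.trans (by rw [le_div_iff₀ hu]; linarith))]
    calc |Real.sin u| ^ (2 * j) ≤ u ^ (2 * j) := by gcongr
      _ = u ^ ((2 * j : ℕ) : ℝ) := (Real.rpow_natCast _ _).symm
      _ ≤ u ^ (α + 1) := Real.rpow_le_rpow_of_exponent_ge hu h (by push_cast; exact hj)
      _ = u ^ α * u := by rw [Real.rpow_add hu, Real.rpow_one]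
  · rw [min_eq_right ((div_le_one hu).2 h |>.trans h)]
    calc |Real.sin u| ^ (2 * j) ≤ 1 := pow_le_one₀ (abs_nonneg _) h1
      _ ≤ u ^ (α - 1) := Real.one_le_rpow h (by linarith)
      _ = u ^ α * (1 / u) := by rw [Real.rpow_sub hu, Real.rpow_one]; ring

theorem dyadicSin_le {α : ℝ} {j : ℕ} (hα : 1 ≤ α) (hj : α + 1 ≤ 2 * j) (L : ℕ) (x : ℝ) :
    dyadicSin α j L x ≤ 4 * |x| ^ α := by
  rcases eq_or_ne x 0 with rfl | hx
  · have : j ≠ 0 := by rintro rfl; norm_num at hj; linarith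
    simp [dyadicSin, this, Real.zero_rpow (by linarith : α ≠ 0)]
  · have hx0 : 0 < |x| := abs_pos.2 hx
    calc dyadicSin α j L x
        ≤ ∑ i ∈ Finset.range (L + 1), |x| ^ α * min (|x| / 2 ^ i) (2 ^ i / |x|) := by
          refine Finset.sum_le_sum fun i _ => ?_
          have h := sin_pow_le_rpow_mul_min hα hj (u := |x| / 2 ^ i) (by positivity)
          have e : |Real.sin (|x| / 2 ^ i)| ^ (2 * j) = Real.sin (x / 2 ^ i) ^ (2 * j) := by
            rw [pow_mul, sq_abs, pow_mul]
            congr 1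
            rcases abs_choice x with h | h <;> rw [h]
            rw [neg_div, Real.sin_neg, neg_sq]
          rw [e, one_div_div, Real.div_rpow (abs_nonneg x) (by positivity)] at h
          calc (2 ^ i : ℝ) ^ α * Real.sin (x / 2 ^ i) ^ (2 * j)
              ≤ (2 ^ i : ℝ) ^ α * (|x| ^ α / (2 ^ i) ^ α * min (|x| / 2 ^ i) (2 ^ i / |x|)) := by
                gcongr
            _ = _ := by
                have : (2 ^ i : ℝ) ^ α ≠ 0 := by positivity
                field_simp
      _ = |x| ^ α * ∑ i ∈ Finset.range (L + 1), min (|x| / 2 ^ i) (2 ^ i / |x|) := by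
          rw [Finset.mul_sum]
      _ ≤ |x| ^ α * 4 := by gcongr; exact sum_min_div_two_pow_le_four _ hx0
      _ = _ := mul_comm _ _

/-- One scale suffices: if `2^n ≤ |x| < 2^(n+1)`, then `u = |x| / 2^(n+1)` lies in `[1/2, 1]`, where
`sin u ≥ u - u^3/4 ≥ 3/8`. The summand `1` covers `|x| ≤ 1`. -/
theorem rpow_le_dyadicSin {α : ℝ} (hα : 0 ≤ α) (j : ℕ) {L : ℕ} {x : ℝ} (hx : |x| < 2 ^ L) :
    |x| ^ α ≤ (8 / 3) ^ (2 * j) * (1 + dyadicSin α j L x) := by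
  have hF := dyadicSin_nonneg α j L x
  have hc : (1 : ℝ) ≤ (8 / 3) ^ (2 * j) := one_le_pow₀ (by norm_num)
  rcases le_total |x| 1 with h | h
  · calc |x| ^ α ≤ 1 := Real.rpow_le_one (abs_nonneg _) h hα
      _ = 1 * 1 := by ring
      _ ≤ _ := by gcongr; linarith
  · obtain ⟨n, hn1, hn2⟩ := exists_nat_pow_near h (one_lt_two (α := ℝ))
    have hnL : n + 1 < L + 1 := by
      have := (pow_lt_pow_iff_right₀ (one_lt_two (α := ℝ))).1 (hn1.trans_lt hx)
      omega
    have hlow : 3 / 8 ≤ |Real.sin (x / 2 ^ (n + 1))| := by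
      set u := |x| / 2 ^ (n + 1) with hu
      have e : |Real.sin (x / 2 ^ (n + 1))| = |Real.sin u| := by
        rw [hu]
        rcases abs_choice x with h | h <;> rw [h]
        rw [neg_div, Real.sin_neg, abs_neg]
      have u1 : 1 / 2 ≤ u := by
        rw [hu, le_div_iff₀ (by positivity), pow_succ]; linarith
      have u2 : u ≤ 1 := by rw [hu, div_le_one (by positivity)]; exact hn2.le
      rw [e]
      refine le_trans ?_ (le_abs_self _)
      have := Real.sin_gt_sub_cube (x := u) (by linarith)
      have h3 : u ^ 3 ≤ u := by
        calc u ^ 3 ≤ u ^ 1 := pow_le_pow_of_le_one (by linarith) u2 (by norm_num)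
          _ = u := pow_one u
      linarith
    have hterm : (2 ^ (n + 1) : ℝ) ^ α * Real.sin (x / 2 ^ (n + 1)) ^ (2 * j)
        ≤ dyadicSin α j L x :=
      Finset.single_le_sum
        (f := fun i : ℕ => (2 ^ i : ℝ) ^ α * Real.sin (x / 2 ^ i) ^ (2 * j))
        (fun i _ => mul_nonneg (by positivity) (by rw [pow_mul]; positivity))
        (Finset.mem_range.2 hnL)
    have h8 : (3 / 8 : ℝ) ^ (2 * j) ≤ Real.sin (x / 2 ^ (n + 1)) ^ (2 * j) := by
      rw [pow_mul (Real.sin _), ← sq_abs, ← pow_mul]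
      gcongr
    calc |x| ^ α ≤ (2 ^ (n + 1) : ℝ) ^ α := by gcongr
      _ = (8 / 3) ^ (2 * j) * ((2 ^ (n + 1) : ℝ) ^ α * (3 / 8) ^ (2 * j)) := by
          rw [mul_left_comm, ← mul_pow]; norm_num
      _ ≤ (8 / 3) ^ (2 * j) * ((2 ^ (n + 1) : ℝ) ^ α * Real.sin (x / 2 ^ (n + 1)) ^ (2 * j)) := by
          gcongr
      _ ≤ _ := by gcongr; linarith

/-! ### Elementary inequalities and expansions. -/

theorem one_add_rpow_le_of_le_one {q t : ℝ} (hq : 1 ≤ q) (h0 : 0 ≤ t) (h1 : t ≤ 1) :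
    (1 + t) ^ q ≤ 1 + 2 ^ q * t := by
  have h := (convexOn_rpow hq).2 (show (1 : ℝ) ∈ Set.Ici 0 by norm_num)
    (show (2 : ℝ) ∈ Set.Ici 0 by norm_num) (sub_nonneg.2 h1) h0 (by ring)
  simp only [smul_eq_mul, Real.one_rpow] at h
  have e : (1 - t) * 1 + t * 2 = 1 + t := by ring
  rw [e] at h
  nlinarith

theorem add_rpow_le_of_le {q x y : ℝ} (hq : 1 ≤ q) (hy : 0 ≤ y) (hyx : y ≤ x) :
    (x + y) ^ q ≤ x ^ q + 2 ^ q * (x ^ (q - 1) * y) := by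
  rcases (hy.trans hyx).eq_or_lt with h | hx
  · obtain rfl : y = 0 := by linarith
    subst h; simp
  · have h := one_add_rpow_le_of_le_one (q := q) (t := y / x) hq (by positivity)
      ((div_le_one hx).2 hyx)
    calc (x + y) ^ q = (x * (1 + y / x)) ^ q := by congr 1; field_simp
      _ = x ^ q * (1 + y / x) ^ q := Real.mul_rpow hx.le (by positivity)
      _ ≤ x ^ q * (1 + 2 ^ q * (y / x)) := by gcongr
      _ = _ := by rw [Real.rpow_sub hx, Real.rpow_one]; field_simp

/-- The pure powers carry coefficient exactly one; a larger constant there would destroy the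
contraction in the induction on the block length. -/
theorem abs_add_rpow_le {q : ℝ} (hq : 1 ≤ q) (x y : ℝ) :
    |x + y| ^ q ≤ |x| ^ q + |y| ^ q
      + 2 ^ q * (|x| ^ (q - 1) * |y| + |y| ^ (q - 1) * |x|) := by
  have hx := abs_nonneg x
  have hy := abs_nonneg y
  have h0 : |x + y| ^ q ≤ (|x| + |y|) ^ q := by gcongr; exact abs_add_le x y
  have a1 : 0 ≤ |x| ^ q := by positivity
  have a2 : 0 ≤ |y| ^ q := by positivity
  have a3 : 0 ≤ (2 : ℝ) ^ q * (|x| ^ (q - 1) * |y|) := by positivity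
  have a4 : 0 ≤ (2 : ℝ) ^ q * (|y| ^ (q - 1) * |x|) := by positivity
  rcases le_total |y| |x| with h | h
  · have := add_rpow_le_of_le hq hy h
    linarith
  · have := add_rpow_le_of_le hq hx h
    rw [add_comm |y|] at this
    linarith

theorem abs_sub_sin_le {γ : ℝ} (h0 : 0 ≤ γ) (h1 : γ ≤ 1) (u : ℝ) :
    |u - Real.sin u| ≤ 2 * |u| ^ (1 + γ) := by
  wlog hu : 0 ≤ u generalizing u
  · have := this (-u) (by linarith)
    rw [Real.sin_neg, abs_neg, ← abs_neg] at this
    convert this using 2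
    ring
  rcases hu.eq_or_lt with rfl | hu
  · simp [Real.zero_rpow (by linarith : 1 + γ ≠ 0)]
  rw [abs_of_nonneg (sub_nonneg.2 (Real.sin_le hu.le)), abs_of_pos hu]
  rcases le_total u 1 with h | h
  · have h3 := Real.sin_gt_sub_cube hu
    have h4 : u ^ 3 ≤ u ^ (1 + γ) := by
      rw [← Real.rpow_natCast]
      exact Real.rpow_le_rpow_of_exponent_ge hu h (by push_cast; linarith)
    have : 0 < u ^ 3 := by positivity
    linarith
  · have h3 : u ^ (1 : ℝ) ≤ u ^ (1 + γ) := Real.rpow_le_rpow_of_exponent_le h (by linarith)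
    rw [Real.rpow_one] at h3
    have : -u ≤ Real.sin u := by
      have := Real.neg_one_le_sin u
      linarith
    linarith

/-- A gap of length `√N` is negligible for the sum, yet its exponential decorrelation beats every
power of `N`. -/
theorem exists_rpow_mul_exp_neg_sqrt_le (a : ℝ) {b : ℝ} (hb : 0 < b) :
    ∃ B : ℝ, 0 < B ∧ ∀ N : ℕ, (1 + N : ℝ) ^ a * Real.exp (-(b * Nat.sqrt N)) ≤ B := by
  have ht := tendsto_rpow_mul_exp_neg_mul_atTop_nhds_zero (2 * |a|) b hb
  have ht2 := ht.comp ((tendsto_natCast_atTop_atTop (R := ℝ)).comp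
    (Filter.tendsto_add_atTop_nat 2))
  obtain ⟨B, hB⟩ := ht2.bddAbove_range
  have hB0 : 0 ≤ B := le_trans (by simp only [Function.comp]; positivity) (hB ⟨0, rfl⟩)
  refine ⟨(B + 1) * Real.exp (2 * b), by positivity, fun N => ?_⟩
  set k := Nat.sqrt N with hk
  have h1 : (1 + N : ℝ) ≤ ((k + 2 : ℕ) : ℝ) ^ (2 : ℝ) := by
    have := Nat.sqrt_le_add N
    rw [← hk] at this
    have : 1 + N ≤ (k + 2) ^ 2 := by nlinarith
    rw [show (2 : ℝ) = ((2 : ℕ) : ℝ) by norm_num, Real.rpow_natCast]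
    exact_mod_cast this
  have h2 := hB ⟨k, rfl⟩
  simp only [Function.comp] at h2
  calc (1 + N : ℝ) ^ a * Real.exp (-(b * k))
      ≤ (((k + 2 : ℕ) : ℝ) ^ (2 : ℝ)) ^ |a| * Real.exp (-(b * k)) := by
        gcongr
        calc (1 + N : ℝ) ^ a ≤ (1 + N : ℝ) ^ |a| :=
              Real.rpow_le_rpow_of_exponent_le (by simp) (le_abs_self a)
          _ ≤ _ := by gcongr
    _ = ((k + 2 : ℕ) : ℝ) ^ (2 * |a|) * Real.exp (-b * (k + 2 : ℕ)) * Real.exp (2 * b) := by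
        rw [← Real.rpow_mul (by positivity), mul_assoc, ← Real.exp_add]
        congr 2; push_cast; ring
    _ ≤ (B + 1) * Real.exp (2 * b) := by gcongr; linarith

theorem sum_range_pow_dist_le {ρ : ℝ} (h0 : 0 ≤ ρ) (h1 : ρ < 1) (n i : ℕ) :
    ∑ j ∈ Finset.range n, ρ ^ Nat.dist i j ≤ 2 * (1 - ρ)⁻¹ := by
  have hg : ∀ s : Finset ℕ, ∑ j ∈ s, ρ ^ j ≤ (1 - ρ)⁻¹ := fun s => by
    rw [← tsum_geometric_of_lt_one h0 h1]
    exact (summable_geometric_of_lt_one h0 h1).sum_le_tsum s fun j _ => by positivity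
  rw [← Finset.sum_filter_add_sum_filter_not _ (fun j => j ≤ i), two_mul]
  refine add_le_add ?_ ?_
  · refine le_trans (le_of_eq ?_) (hg (((Finset.range n).filter (· ≤ i)).image (i - ·)))
    rw [Finset.sum_image]
    · refine Finset.sum_congr rfl fun j hj => ?_
      rw [Nat.dist_eq_sub_of_le_right (Finset.mem_filter.1 hj).2]
    · intro x hx y hy h
      have := (Finset.mem_filter.1 hx).2
      have := (Finset.mem_filter.1 hy).2
      simp only at h; omega
  · refine le_trans (le_of_eq ?_) (hg (((Finset.range n).filter (¬ · ≤ i)).image (· - i)))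
    rw [Finset.sum_image]
    · refine Finset.sum_congr rfl fun j hj => ?_
      rw [Nat.dist_eq_sub_of_le (not_le.1 (Finset.mem_filter.1 hj).2).le]
    · intro x hx y hy h
      have := (Finset.mem_filter.1 hx).2
      have := (Finset.mem_filter.1 hy).2
      simp only at h; omega

/-- Binomial expansion of Euler's formula. Since the coefficients have total mass one, decorrelation
errors pass to powers of sines without loss. -/
theorem exists_sin_pow_eq_sum_exp (a : ℕ) :
    ∃ c : ℕ → ℂ, ∑ l ∈ Finset.range (a + 1), ‖c l‖ = 1 ∧ ∀ u : ℝ,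
      ((Real.sin u ^ a : ℝ) : ℂ)
        = ∑ l ∈ Finset.range (a + 1), c l * Complex.exp (Complex.I * ((2 * l - a) * u : ℝ)) := by
  refine ⟨fun l => (a.choose l : ℂ) * (Complex.I / 2) ^ a * (-1) ^ l, ?_, fun u => ?_⟩
  · simp only [norm_mul, norm_pow, norm_neg, norm_one, one_pow, mul_one, norm_div, Complex.norm_I,
      Complex.norm_natCast, ← Finset.sum_mul]
    rw [← Nat.cast_sum, Nat.sum_range_choose]
    simp
  · have hs : ((Real.sin u : ℝ) : ℂ) = Complex.I / 2
        * (-Complex.exp (Complex.I * u) + Complex.exp (-(Complex.I * u))) := by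
      rw [Complex.ofReal_sin, Complex.sin]
      rw [neg_mul, mul_comm (u : ℂ)]; ring
    rw [Complex.ofReal_pow, hs, mul_pow, add_pow, Finset.mul_sum]
    refine Finset.sum_congr rfl fun l hl => ?_
    have hl : l ≤ a := Nat.lt_succ_iff.1 (Finset.mem_range.1 hl)
    rw [neg_pow, ← Complex.exp_nat_mul, ← Complex.exp_nat_mul]
    have : Complex.exp (Complex.I * ((2 * l - a) * u : ℝ))
        = Complex.exp (l * (Complex.I * u)) * Complex.exp ((a - l : ℕ) * -(Complex.I * u)) := by
      rw [← Complex.exp_add]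
      congr 1
      push_cast [Nat.cast_sub hl]
      ring
    rw [this]; ring

theorem eLpNorm_ofReal_le_iff {Ω : Type*} [MeasurableSpace Ω] {μ : Measure Ω} {X : Ω → ℝ}
    {q M : ℝ} (hq : 0 < q) (hX : MemLp X (ENNReal.ofReal q) μ) (hM : 0 ≤ M) :
    eLpNorm X (ENNReal.ofReal q) μ ≤ ENNReal.ofReal M ↔ ∫ ω, |X ω| ^ q ∂μ ≤ M ^ q := by
  rw [hX.eLpNorm_eq_integral_rpow_norm (by simpa using hq) ENNReal.ofReal_ne_top,
    ENNReal.toReal_ofReal hq.le, ENNReal.ofReal_le_ofReal_iff hM]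
  simp only [Real.norm_eq_abs]
  rw [Real.rpow_inv_le_iff_of_pos (integral_nonneg fun ω => by positivity) hM hq]

theorem MeasureTheory.MemLp.integrable_abs_rpow {Ω : Type*} [MeasurableSpace Ω] {μ : Measure Ω}
    [IsProbabilityMeasure μ] {X : Ω → ℝ} {p r : ℝ} (hX : MemLp X (ENNReal.ofReal p) μ)
    (hr : 0 < r) (hrp : r ≤ p) : Integrable (fun ω => |X ω| ^ r) μ := by
  have h := (hX.mono_exponent (ENNReal.ofReal_le_ofReal hrp)).integrable_norm_rpow
    (by simpa using hr) ENNReal.ofReal_ne_top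
  simpa [ENNReal.toReal_ofReal hr.le] using h

theorem rpow_mul_rpow_le_add {x y α β : ℝ} (hx : 0 ≤ x) (hy : 0 ≤ y) (hα : 0 ≤ α) (hβ : 0 ≤ β) :
    x ^ α * y ^ β ≤ x ^ (α + β) + y ^ (α + β) := by
  have h1 : 0 ≤ x ^ (α + β) := by positivity
  have h2 : 0 ≤ y ^ (α + β) := by positivity
  rcases le_total x y with h | h
  · calc x ^ α * y ^ β ≤ y ^ α * y ^ β := by gcongr
      _ = y ^ (α + β) := (Real.rpow_add_of_nonneg hy hα hβ).symm
      _ ≤ _ := by linarith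
  · calc x ^ α * y ^ β ≤ x ^ α * x ^ β := by gcongr
      _ = x ^ (α + β) := (Real.rpow_add_of_nonneg hx hα hβ).symm
      _ ≤ _ := by linarith

theorem integrable_rpow_mul_rpow {Ω : Type*} [MeasurableSpace Ω] {μ : Measure Ω}
    [IsProbabilityMeasure μ] {X Y : Ω → ℝ} {p α β : ℝ} (hX : MemLp X (ENNReal.ofReal p) μ)
    (hY : MemLp Y (ENNReal.ofReal p) μ) (hα : 0 ≤ α) (hβ : 0 ≤ β) (h0 : 0 < α + β)
    (hp : α + β ≤ p) : Integrable (fun ω => |X ω| ^ α * |Y ω| ^ β) μ := by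
  refine ((hX.integrable_abs_rpow h0 hp).fun_add (hY.integrable_abs_rpow h0 hp)).mono' ?_ ?_
  · have h1 := hX.aestronglyMeasurable.aemeasurable
    have h2 := hY.aestronglyMeasurable.aemeasurable
    exact AEMeasurable.aestronglyMeasurable (by fun_prop)
  · refine Filter.Eventually.of_forall fun ω => ?_
    rw [Real.norm_of_nonneg (by positivity)]
    exact rpow_mul_rpow_le_add (abs_nonneg _) (abs_nonneg _) hα hβ

/-! ### From characteristic functions to covariances and cross moments. -/

/-- The joint characteristic function of `X` and `Y` is `R`-close to the product of the marginal
ones, at frequencies of size at most `ε`. -/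
def CharFunDecorrelated {Ω : Type*} [MeasurableSpace Ω] (μ : Measure Ω) (X Y : Ω → ℝ)
    (ε R : ℝ) : Prop :=
  ∀ s t : ℝ, |s| ≤ ε → |t| ≤ ε →
    ‖(∫ ω, Complex.exp (Complex.I * (s * X ω + t * Y ω : ℝ)) ∂μ)
      - (∫ ω, Complex.exp (Complex.I * (s * X ω : ℝ)) ∂μ)
        * (∫ ω, Complex.exp (Complex.I * (t * Y ω : ℝ)) ∂μ)‖ ≤ R

theorem integrable_exp_I_mul {Ω : Type*} [MeasurableSpace Ω] {μ : Measure Ω}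
    [IsProbabilityMeasure μ] {X : Ω → ℝ} (hX : AEMeasurable X μ) :
    Integrable (fun ω => Complex.exp (Complex.I * (X ω : ℝ))) μ := by
  refine Integrable.of_bound (C := 1) ?_ (Filter.Eventually.of_forall fun ω => ?_)
  · exact (Complex.continuous_exp.measurable.comp_aemeasurable
      (by fun_prop)).aestronglyMeasurable
  · rw [mul_comm, Complex.norm_exp_ofReal_mul_I]

theorem CharFunDecorrelated.sin_pow {Ω : Type*} [MeasurableSpace Ω] {μ : Measure Ω}
    [IsProbabilityMeasure μ] {X Y : Ω → ℝ} {ε R : ℝ} (h : CharFunDecorrelated μ X Y ε R)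
    (hX : AEMeasurable X μ) (hY : AEMeasurable Y μ) (a b : ℕ) {s t : ℝ}
    (hs : a * |s| ≤ ε) (ht : b * |t| ≤ ε) :
    |(∫ ω, Real.sin (s * X ω) ^ a * Real.sin (t * Y ω) ^ b ∂μ)
      - (∫ ω, Real.sin (s * X ω) ^ a ∂μ) * ∫ ω, Real.sin (t * Y ω) ^ b ∂μ| ≤ R := by
  have freq : ∀ (a l : ℕ) (s : ℝ), l ∈ Finset.range (a + 1) → a * |s| ≤ ε →
      |(2 * l - a) * s| ≤ ε := by
    intro a l s hl hs
    have hl : (l : ℝ) ≤ a := by exact_mod_cast Nat.lt_succ_iff.1 (Finset.mem_range.1 hl)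
    have hl0 : (0 : ℝ) ≤ l := l.cast_nonneg
    rw [abs_mul]
    refine le_trans ?_ hs
    gcongr
    rw [abs_le]; constructor <;> linarith
  obtain ⟨c, hc1, hc⟩ := exists_sin_pow_eq_sum_exp a
  obtain ⟨e, he1, he⟩ := exists_sin_pow_eq_sum_exp b
  have i1 : ((∫ ω, Real.sin (s * X ω) ^ a ∂μ : ℝ) : ℂ) = ∑ l ∈ Finset.range (a + 1),
      c l * ∫ ω, Complex.exp (Complex.I * ((2 * l - a) * s * X ω : ℝ)) ∂μ := by
    rw [← integral_complex_ofReal]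
    simp only [hc]
    rw [integral_finsetSum]
    · refine Finset.sum_congr rfl fun l _ => ?_
      rw [integral_const_mul]
      simp only [mul_assoc]
    · intro l _
      exact (integrable_exp_I_mul (by fun_prop)).const_mul _
  have i2 : ((∫ ω, Real.sin (t * Y ω) ^ b ∂μ : ℝ) : ℂ) = ∑ l ∈ Finset.range (b + 1),
      e l * ∫ ω, Complex.exp (Complex.I * ((2 * l - b) * t * Y ω : ℝ)) ∂μ := by
    rw [← integral_complex_ofReal]
    simp only [he]
    rw [integral_finsetSum]
    · refine Finset.sum_congr rfl fun l _ => ?_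
      rw [integral_const_mul]
      simp only [mul_assoc]
    · intro l _
      exact (integrable_exp_I_mul (by fun_prop)).const_mul _
  have i3 : ((∫ ω, Real.sin (s * X ω) ^ a * Real.sin (t * Y ω) ^ b ∂μ : ℝ) : ℂ)
      = ∑ l ∈ Finset.range (a + 1), ∑ l' ∈ Finset.range (b + 1), c l * e l' *
        ∫ ω, Complex.exp (Complex.I *
          ((2 * l - a) * s * X ω + (2 * l' - b) * t * Y ω : ℝ)) ∂μ := by
    rw [← integral_complex_ofReal]
    have : ∀ ω, ((Real.sin (s * X ω) ^ a * Real.sin (t * Y ω) ^ b : ℝ) : ℂ)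
        = ∑ l ∈ Finset.range (a + 1), ∑ l' ∈ Finset.range (b + 1), c l * e l' *
        Complex.exp (Complex.I * ((2 * l - a) * s * X ω + (2 * l' - b) * t * Y ω : ℝ)) := by
      intro ω
      rw [Complex.ofReal_mul, hc, he, Finset.sum_mul_sum]
      refine Finset.sum_congr rfl fun l _ => Finset.sum_congr rfl fun l' _ => ?_
      rw [mul_mul_mul_comm, ← Complex.exp_add, Complex.ofReal_add, mul_add]
      simp only [mul_assoc]
    simp only [this]
    have hint : ∀ l l' : ℕ, Integrable (fun ω => c l * e l' * Complex.exp (Complex.I *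
        ((2 * l - a) * s * X ω + (2 * l' - b) * t * Y ω : ℝ))) μ := fun l l' =>
      (integrable_exp_I_mul (by fun_prop)).const_mul _
    rw [integral_finsetSum _ fun l _ => integrable_finsetSum _ fun l' _ => hint l l']
    refine Finset.sum_congr rfl fun l _ => ?_
    rw [integral_finsetSum _ fun l' _ => hint l l']
    refine Finset.sum_congr rfl fun l' _ => integral_const_mul _ _
  rw [← Real.norm_eq_abs, ← Complex.norm_real, Complex.ofReal_sub, Complex.ofReal_mul, i1, i2, i3,
    Finset.sum_mul_sum, ← Finset.sum_sub_distrib]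
  simp only [← Finset.sum_sub_distrib]
  calc _ ≤ ∑ l ∈ Finset.range (a + 1), ∑ l' ∈ Finset.range (b + 1), ‖c l‖ * ‖e l'‖ * R := by
        refine norm_sum_le_of_le _ fun l hl => norm_sum_le_of_le _ fun l' hl' => ?_
        rw [mul_mul_mul_comm, ← mul_sub, norm_mul, norm_mul]
        gcongr
        exact h _ _ (freq a l s hl hs) (freq b l' t hl' ht)
    _ = R := by
        simp only [← Finset.sum_mul, ← Finset.mul_sum, hc1, he1, one_mul]

theorem integrable_sin_pow {Ω : Type*} [MeasurableSpace Ω] {μ : Measure Ω}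
    [IsProbabilityMeasure μ] {X : Ω → ℝ} (hX : AEMeasurable X μ) (s : ℝ) (a : ℕ) :
    Integrable (fun ω => Real.sin (s * X ω) ^ a) μ := by
  refine Integrable.of_bound (C := 1) ?_ (Filter.Eventually.of_forall fun ω => ?_)
  · exact AEMeasurable.aestronglyMeasurable (by fun_prop)
  · rw [norm_pow]
    exact pow_le_one₀ (norm_nonneg _) (Real.abs_sin_le_one _)

theorem integrable_sin_pow_mul_sin_pow {Ω : Type*} [MeasurableSpace Ω] {μ : Measure Ω}
    [IsProbabilityMeasure μ] {X Y : Ω → ℝ} (hX : AEMeasurable X μ) (hY : AEMeasurable Y μ)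
    (s t : ℝ) (a b : ℕ) :
    Integrable (fun ω => Real.sin (s * X ω) ^ a * Real.sin (t * Y ω) ^ b) μ := by
  refine Integrable.of_bound (C := 1) ?_ (Filter.Eventually.of_forall fun ω => ?_)
  · exact AEMeasurable.aestronglyMeasurable (by fun_prop)
  · rw [norm_mul, norm_pow, norm_pow]
    exact mul_le_one₀ (pow_le_one₀ (norm_nonneg _) (Real.abs_sin_le_one _)) (by positivity)
      (pow_le_one₀ (norm_nonneg _) (Real.abs_sin_le_one _))

theorem abs_sub_sin_div_le {γ s : ℝ} (h0 : 0 ≤ γ) (h1 : γ ≤ 1) (hs : 0 < s) (x : ℝ) :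
    |x - Real.sin (s * x) / s| ≤ 2 * s ^ γ * |x| ^ (1 + γ) := by
  have h := abs_sub_sin_le h0 h1 (s * x)
  rw [abs_mul, abs_of_pos hs, Real.mul_rpow hs.le (abs_nonneg _), Real.rpow_add hs,
    Real.rpow_one] at h
  have e : x - Real.sin (s * x) / s = (s * x - Real.sin (s * x)) / s := by field_simp
  rw [e, abs_div, abs_of_pos hs, div_le_iff₀ hs]
  linarith

theorem abs_mul_sub_sin_mul_sin_div_le {γ s : ℝ} (h0 : 0 ≤ γ) (h1 : γ ≤ 1) (hs : 0 < s)
    (x y : ℝ) : |x * y - Real.sin (s * x) * Real.sin (s * y) / s ^ 2|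
      ≤ 4 * s ^ γ * (|x| ^ (2 + γ) + |y| ^ (2 + γ)) := by
  have hx := abs_sub_sin_div_le h0 h1 hs x
  have hy := abs_sub_sin_div_le h0 h1 hs y
  have hy' : |Real.sin (s * y) / s| ≤ |y| := by
    rw [abs_div, abs_of_pos hs, div_le_iff₀ hs]
    have := Real.abs_sin_le_abs (x := s * y)
    rw [abs_mul, abs_of_pos hs] at this
    linarith
  have e : x * y - Real.sin (s * x) * Real.sin (s * y) / s ^ 2
      = x * (y - Real.sin (s * y) / s)
        + (x - Real.sin (s * x) / s) * (Real.sin (s * y) / s) := by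
    field_simp; ring
  have m1 := rpow_mul_rpow_le_add (abs_nonneg x) (abs_nonneg y) zero_le_one
    (by linarith : 0 ≤ 1 + γ)
  have m2 := rpow_mul_rpow_le_add (abs_nonneg x) (abs_nonneg y) (by linarith : 0 ≤ 1 + γ)
    zero_le_one
  rw [Real.rpow_one, show 1 + (1 + γ) = 2 + γ by ring] at m1
  rw [Real.rpow_one, show 1 + γ + 1 = 2 + γ by ring] at m2
  have hsγ : 0 ≤ s ^ γ := by positivity
  rw [e]
  calc _ ≤ |x| * |y - Real.sin (s * y) / s|
        + |x - Real.sin (s * x) / s| * |Real.sin (s * y) / s| := by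
        rw [← abs_mul, ← abs_mul]; exact abs_add_le _ _
    _ ≤ |x| * (2 * s ^ γ * |y| ^ (1 + γ)) + (2 * s ^ γ * |x| ^ (1 + γ)) * |y| := by gcongr
    _ = 2 * s ^ γ * (|x| * |y| ^ (1 + γ)) + 2 * s ^ γ * (|x| ^ (1 + γ) * |y|) := by ring
    _ ≤ 2 * s ^ γ * (|x| ^ (2 + γ) + |y| ^ (2 + γ))
        + 2 * s ^ γ * (|x| ^ (2 + γ) + |y| ^ (2 + γ)) := by gcongr
    _ = _ := by ring

/-- As `X` is centered, only the error of `sin (s X) ≈ s X` contributes, whence the gain `s ^ γ`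
over the trivial order `s`. -/
theorem abs_integral_sin_le {Ω : Type*} [MeasurableSpace Ω] {μ : Measure Ω}
    [IsProbabilityMeasure μ] {X : Ω → ℝ} {γ M s : ℝ} (h0 : 0 < γ) (h1 : γ ≤ 1)
    (hX : MemLp X (ENNReal.ofReal (2 + γ)) μ) (hX0 : ∫ ω, X ω ∂μ = 0)
    (hXM : ∫ ω, |X ω| ^ (2 + γ) ∂μ ≤ M) (hs : 0 < s) :
    |∫ ω, Real.sin (s * X ω) ∂μ| ≤ 2 * s * s ^ γ * (1 + M) := by
  have hXi : Integrable X μ := hX.integrable (by rw [ENNReal.one_le_ofReal]; linarith)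
  have hsin : Integrable (fun ω => Real.sin (s * X ω)) μ := by
    simpa using integrable_sin_pow hXi.aemeasurable s 1
  have e : ∫ ω, Real.sin (s * X ω) ∂μ = -∫ ω, s * (X ω - Real.sin (s * X ω) / s) ∂μ := by
    have : ∀ ω, s * (X ω - Real.sin (s * X ω) / s) = s * X ω - Real.sin (s * X ω) := by
      intro ω; field_simp
    simp only [this]
    rw [integral_sub (hXi.const_mul s) hsin, integral_const_mul, hX0]; ring
  have hi := hX.integrable_abs_rpow (by linarith : 0 < 2 + γ) le_rfl
  rw [e, abs_neg, ← Real.norm_eq_abs]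
  calc ‖∫ ω, s * (X ω - Real.sin (s * X ω) / s) ∂μ‖
      ≤ ∫ ω, 2 * s * s ^ γ * (1 + |X ω| ^ (2 + γ)) ∂μ := by
        refine norm_integral_le_of_norm_le (((integrable_const _).fun_add hi).const_mul _)
          (Filter.Eventually.of_forall fun ω => ?_)
        rw [Real.norm_eq_abs, abs_mul, abs_of_pos hs]
        have h2 : |X ω| ^ (1 + γ) ≤ 1 + |X ω| ^ (2 + γ) := by
          have hx := abs_nonneg (X ω)
          have : 0 ≤ |X ω| ^ (2 + γ) := by positivity
          rcases le_total |X ω| 1 with h | h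
          · linarith [Real.rpow_le_one hx h (by linarith : 0 ≤ 1 + γ)]
          · linarith [Real.rpow_le_rpow_of_exponent_le h (by linarith : 1 + γ ≤ 2 + γ)]
        calc s * |X ω - Real.sin (s * X ω) / s| ≤ s * (2 * s ^ γ * |X ω| ^ (1 + γ)) := by
              gcongr; exact abs_sub_sin_div_le h0.le h1 hs _
          _ ≤ s * (2 * s ^ γ * (1 + |X ω| ^ (2 + γ))) := by gcongr
          _ = _ := by ring
    _ = 2 * s * s ^ γ * (1 + ∫ ω, |X ω| ^ (2 + γ) ∂μ) := by
        rw [integral_const_mul, integral_add (integrable_const _) hi]; simp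
    _ ≤ _ := by gcongr

/-- `X Y` is replaced by `sin (s X) sin (s Y) / s ^ 2`, whose expectation almost factors into two
small means. The scale `s` stays free, to balance the amplified error `R / s ^ 2` against the
approximation error `s ^ γ`. -/
theorem CharFunDecorrelated.abs_integral_mul_le {Ω : Type*} [MeasurableSpace Ω] {μ : Measure Ω}
    [IsProbabilityMeasure μ] {X Y : Ω → ℝ} {ε R γ M s : ℝ}
    (h : CharFunDecorrelated μ X Y ε R) (h0 : 0 < γ) (h1 : γ ≤ 1)
    (hX : MemLp X (ENNReal.ofReal (2 + γ)) μ) (hY : MemLp Y (ENNReal.ofReal (2 + γ)) μ)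
    (hX0 : ∫ ω, X ω ∂μ = 0) (hY0 : ∫ ω, Y ω ∂μ = 0)
    (hXM : ∫ ω, |X ω| ^ (2 + γ) ∂μ ≤ M) (hYM : ∫ ω, |Y ω| ^ (2 + γ) ∂μ ≤ M)
    (hs : 0 < s) (hs1 : s ≤ 1) (hsε : s ≤ ε) :
    |∫ ω, X ω * Y ω ∂μ| ≤ R / s ^ 2 + 12 * (1 + M) ^ 2 * s ^ γ := by
  have hXm := hX.aestronglyMeasurable.aemeasurable
  have hYm := hY.aestronglyMeasurable.aemeasurable
  have hM : 0 ≤ M := le_trans (integral_nonneg fun ω => by positivity) hXM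
  have hXi := hX.integrable_abs_rpow (by linarith : 0 < 2 + γ) le_rfl
  have hYi := hY.integrable_abs_rpow (by linarith : 0 < 2 + γ) le_rfl
  have two_le : (2 : ℝ≥0∞) ≤ ENNReal.ofReal (2 + γ) := by
    rw [← ENNReal.ofReal_ofNat]; exact ENNReal.ofReal_le_ofReal (by linarith)
  have hXY : Integrable (fun ω => X ω * Y ω) μ :=
    (hX.mono_exponent two_le).integrable_mul (hY.mono_exponent two_le)
  have hss : Integrable (fun ω => Real.sin (s * X ω) * Real.sin (s * Y ω)) μ := by
    simpa using integrable_sin_pow_mul_sin_pow hXm hYm s s 1 1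
  have hcov := h.sin_pow hXm hYm 1 1 (s := s) (t := s) (by simpa [abs_of_pos hs] using hsε)
    (by simpa [abs_of_pos hs] using hsε)
  simp only [pow_one] at hcov
  have hmX := abs_integral_sin_le h0 h1 hX hX0 hXM hs
  have hmY := abs_integral_sin_le h0 h1 hY hY0 hYM hs
  have hdiff : |(∫ ω, X ω * Y ω ∂μ)
      - (∫ ω, Real.sin (s * X ω) * Real.sin (s * Y ω) ∂μ) / s ^ 2| ≤ 4 * s ^ γ * (M + M) := by
    rw [← integral_div, ← integral_sub hXY (hss.div_const _), ← Real.norm_eq_abs]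
    calc _ ≤ ∫ ω, 4 * s ^ γ * (|X ω| ^ (2 + γ) + |Y ω| ^ (2 + γ)) ∂μ :=
          norm_integral_le_of_norm_le ((hXi.fun_add hYi).const_mul _)
            (Filter.Eventually.of_forall fun ω =>
              abs_mul_sub_sin_mul_sin_div_le h0.le h1 hs _ _)
      _ ≤ _ := by
          rw [integral_const_mul, integral_add hXi hYi]; gcongr
  have hprod : |(∫ ω, Real.sin (s * X ω) ∂μ) * ∫ ω, Real.sin (s * Y ω) ∂μ|
      ≤ s ^ 2 * (4 * (1 + M) ^ 2 * s ^ γ) := by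
    have hsγ : s ^ γ ≤ 1 := Real.rpow_le_one hs.le hs1 h0.le
    rw [abs_mul]
    calc _ ≤ (2 * s * s ^ γ * (1 + M)) * (2 * s * s ^ γ * (1 + M)) := by gcongr
      _ = s ^ 2 * (4 * (1 + M) ^ 2 * (s ^ γ * s ^ γ)) := by ring
      _ ≤ s ^ 2 * (4 * (1 + M) ^ 2 * (s ^ γ * 1)) := by gcongr
      _ = _ := by ring
  have hs2 : 0 < s ^ 2 := by positivity
  have hsin : |∫ ω, Real.sin (s * X ω) * Real.sin (s * Y ω) ∂μ|
      ≤ R + s ^ 2 * (4 * (1 + M) ^ 2 * s ^ γ) := by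
    have := abs_sub_abs_le_abs_sub (∫ ω, Real.sin (s * X ω) * Real.sin (s * Y ω) ∂μ)
      ((∫ ω, Real.sin (s * X ω) ∂μ) * ∫ ω, Real.sin (s * Y ω) ∂μ)
    linarith
  have hsin' : |(∫ ω, Real.sin (s * X ω) * Real.sin (s * Y ω) ∂μ) / s ^ 2|
      ≤ R / s ^ 2 + 4 * (1 + M) ^ 2 * s ^ γ := by
    rw [abs_div, abs_of_pos hs2, div_le_iff₀ hs2, add_mul, div_mul_cancel₀ _ hs2.ne']
    linarith
  have := abs_sub_abs_le_abs_sub (∫ ω, X ω * Y ω ∂μ)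
    ((∫ ω, Real.sin (s * X ω) * Real.sin (s * Y ω) ∂μ) / s ^ 2)
  have hfin : 4 * s ^ γ * (M + M) ≤ 8 * (1 + M) ^ 2 * s ^ γ := by
    have : 0 ≤ s ^ γ := by positivity
    nlinarith [mul_nonneg this hM, mul_nonneg this (mul_nonneg hM hM)]
  linarith

theorem integrable_dyadicSin {Ω : Type*} [MeasurableSpace Ω] {μ : Measure Ω}
    [IsProbabilityMeasure μ] {X : Ω → ℝ} (hX : AEMeasurable X μ) (α : ℝ) (j L : ℕ) :
    Integrable (fun ω => dyadicSin α j L (X ω)) μ := by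
  refine integrable_finsetSum _ fun i _ => Integrable.const_mul ?_ _
  simpa only [div_eq_inv_mul] using integrable_sin_pow hX ((2 ^ i)⁻¹ : ℝ) (2 * j)

theorem CharFunDecorrelated.dyadicSin {Ω : Type*} [MeasurableSpace Ω] {μ : Measure Ω}
    [IsProbabilityMeasure μ] {X Y : Ω → ℝ} {R : ℝ} {j : ℕ}
    (h : CharFunDecorrelated μ X Y (2 * j) R) (hX : AEMeasurable X μ) (hY : AEMeasurable Y μ)
    {α β : ℝ} (hα : 0 ≤ α) (hβ : 0 ≤ β) (L : ℕ) :
    Integrable (fun ω => dyadicSin α j L (X ω) * dyadicSin β j L (Y ω)) μ ∧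
    ∫ ω, dyadicSin α j L (X ω) * dyadicSin β j L (Y ω) ∂μ
      ≤ (∫ ω, dyadicSin α j L (X ω) ∂μ) * (∫ ω, dyadicSin β j L (Y ω) ∂μ)
        + (2 ^ L : ℝ) ^ (α + β + 2) * R := by
  have hR : 0 ≤ R := le_trans (norm_nonneg _) (h 0 0 (by simp) (by simp))
  have hterm : ∀ i i' : ℕ, Integrable (fun ω =>
      ((2 ^ i : ℝ) ^ α * Real.sin (X ω / 2 ^ i) ^ (2 * j))
        * ((2 ^ i' : ℝ) ^ β * Real.sin (Y ω / 2 ^ i') ^ (2 * j))) μ := by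
    intro i i'
    have := (integrable_sin_pow_mul_sin_pow hX hY ((2 ^ i)⁻¹ : ℝ) ((2 ^ i')⁻¹ : ℝ)
      (2 * j) (2 * j)).const_mul ((2 ^ i : ℝ) ^ α * (2 ^ i' : ℝ) ^ β)
    refine this.congr (Filter.Eventually.of_forall fun ω => ?_)
    simp only [div_eq_inv_mul]
    ring
  have hi1 : ∀ (Z : Ω → ℝ) (hZ : AEMeasurable Z μ) (δ : ℝ) (i : ℕ), Integrable (fun ω =>
      (2 ^ i : ℝ) ^ δ * Real.sin (Z ω / 2 ^ i) ^ (2 * j)) μ := by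
    intro Z hZ δ i
    simpa only [div_eq_inv_mul] using
      (integrable_sin_pow hZ ((2 ^ i)⁻¹ : ℝ) (2 * j)).const_mul ((2 ^ i : ℝ) ^ δ)
  simp only [_root_.dyadicSin, Finset.sum_mul_sum]
  refine ⟨integrable_finsetSum _ fun i _ => integrable_finsetSum _ fun i' _ => hterm i i', ?_⟩
  rw [integral_finsetSum _ fun i _ => integrable_finsetSum _ fun i' _ => hterm i i',
    integral_finsetSum _ fun i _ => hi1 X hX α i, integral_finsetSum _ fun i _ => hi1 Y hY β i,
    Finset.sum_mul_sum, ← sub_le_iff_le_add', ← Finset.sum_sub_distrib]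
  have hfreq : ∀ i : ℕ, ((2 * j : ℕ) : ℝ) * |((2 : ℝ) ^ i)⁻¹| ≤ 2 * j := by
    intro i
    push_cast
    rw [abs_of_pos (by positivity)]
    refine mul_le_of_le_one_right (by positivity) (inv_le_one_of_one_le₀ (one_le_pow₀ one_le_two))
  have hbound : ∀ i ∈ Finset.range (L + 1), ∀ i' ∈ Finset.range (L + 1),
      (∫ ω, ((2 ^ i : ℝ) ^ α * Real.sin (X ω / 2 ^ i) ^ (2 * j))
        * ((2 ^ i' : ℝ) ^ β * Real.sin (Y ω / 2 ^ i') ^ (2 * j)) ∂μ)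
      - (∫ ω, (2 ^ i : ℝ) ^ α * Real.sin (X ω / 2 ^ i) ^ (2 * j) ∂μ)
        * (∫ ω, (2 ^ i' : ℝ) ^ β * Real.sin (Y ω / 2 ^ i') ^ (2 * j) ∂μ)
      ≤ (2 ^ L : ℝ) ^ (α + β) * R := by
    intro i hi i' hi'
    have hc := (le_abs_self _).trans (h.sin_pow hX hY (2 * j) (2 * j) (hfreq i) (hfreq i'))
    have hL : ∀ i ∈ Finset.range (L + 1), (2 : ℝ) ^ i ≤ 2 ^ L := fun i hi =>
      pow_le_pow_right₀ one_le_two (Nat.lt_succ_iff.1 (Finset.mem_range.1 hi))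
    simp only [mul_mul_mul_comm, integral_const_mul, div_eq_inv_mul, ← mul_sub]
    rw [Real.rpow_add (by positivity)]
    calc _ ≤ (2 ^ i : ℝ) ^ α * (2 ^ i' : ℝ) ^ β * R := by gcongr
      _ ≤ _ := by gcongr ?_ ^ α * ?_ ^ β * R <;> [exact hL i hi; exact hL i' hi']
  calc _ ≤ ∑ i ∈ Finset.range (L + 1), ∑ i' ∈ Finset.range (L + 1),
        (2 ^ L : ℝ) ^ (α + β) * R := by
        refine Finset.sum_le_sum fun i hi => ?_
        rw [integral_finsetSum _ fun i' _ => hterm i i', ← Finset.sum_sub_distrib]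
        exact Finset.sum_le_sum fun i' hi' => hbound i hi i' hi'
    _ = (2 ^ L : ℝ) ^ (α + β) * (((L : ℝ) + 1) ^ (2 : ℕ)) * R := by
        simp only [Finset.sum_const, Finset.card_range, nsmul_eq_mul]; push_cast; ring
    -- The crude count `L + 1 ≤ 2 ^ L` of scales explains the extra `2` in the exponent.
    _ ≤ (2 ^ L : ℝ) ^ (α + β) * ((2 ^ L : ℝ) ^ (2 : ℕ)) * R := by
        gcongr
        exact_mod_cast Nat.lt_two_pow_self (n := L)
    _ = _ := by
        rw [Real.rpow_add (by positivity) (α + β) 2, Real.rpow_ofNat]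

theorem rpow_mul_rpow_le_dyadicSin {α β p : ℝ} (hα : 0 ≤ α) (hβ : 0 ≤ β) (hp : α + β ≤ p)
    (j L : ℕ) (x y : ℝ) :
    |x| ^ α * |y| ^ β ≤
      ((8 / 3) ^ (2 * j)) ^ 2 * ((1 + dyadicSin α j L x) * (1 + dyadicSin β j L y))
        + (2 ^ L : ℝ) ^ (α + β - p) * (|x| ^ p + |y| ^ p) := by
  have hx := abs_nonneg x
  have hy := abs_nonneg y
  have f1 := dyadicSin_nonneg α j L x
  have f2 := dyadicSin_nonneg β j L y
  have tail : ∀ m : ℝ, (2 : ℝ) ^ L ≤ m → m ^ (α + β) ≤ (2 ^ L : ℝ) ^ (α + β - p) * m ^ p := by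
    intro m hm
    have hL : (0 : ℝ) < 2 ^ L := by positivity
    have hm0 : 0 < m := hL.trans_le hm
    calc m ^ (α + β) = m ^ (α + β - p) * m ^ p := by rw [← Real.rpow_add hm0]; ring_nf
      _ ≤ _ := by
        gcongr ?_ * _
        exact Real.rpow_le_rpow_of_nonpos hL hm (by linarith)
  by_cases h : |x| < 2 ^ L ∧ |y| < 2 ^ L
  · have h1 := rpow_le_dyadicSin hα j h.1
    have h2 := rpow_le_dyadicSin hβ j h.2
    have h3 : 0 ≤ (2 ^ L : ℝ) ^ (α + β - p) * (|x| ^ p + |y| ^ p) := by positivity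
    calc |x| ^ α * |y| ^ β ≤ ((8 / 3) ^ (2 * j) * (1 + dyadicSin α j L x))
          * ((8 / 3) ^ (2 * j) * (1 + dyadicSin β j L y)) := by gcongr
      _ = ((8 / 3) ^ (2 * j)) ^ 2 * ((1 + dyadicSin α j L x) * (1 + dyadicSin β j L y)) := by ring
      _ ≤ _ := by linarith
  · have h3 : 0 ≤ ((8 / 3 : ℝ) ^ (2 * j)) ^ 2
        * ((1 + dyadicSin α j L x) * (1 + dyadicSin β j L y)) := by positivity
    have hm : (2 : ℝ) ^ L ≤ max |x| |y| := by
      rw [le_max_iff]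
      by_contra! h'
      exact h h'
    have hxp : 0 ≤ |x| ^ p := by positivity
    have hyp : 0 ≤ |y| ^ p := by positivity
    calc |x| ^ α * |y| ^ β ≤ (max |x| |y|) ^ α * (max |x| |y|) ^ β := by
          gcongr <;> simp
      _ = (max |x| |y|) ^ (α + β) :=
          (Real.rpow_add_of_nonneg (le_max_of_le_left hx) hα hβ).symm
      _ ≤ (2 ^ L : ℝ) ^ (α + β - p) * (max |x| |y|) ^ p := tail _ hm
      _ ≤ (2 ^ L : ℝ) ^ (α + β - p) * (|x| ^ p + |y| ^ p) := by
          gcongr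
          rcases max_choice |x| |y| with h | h <;> rw [h] <;> linarith
      _ ≤ _ := by linarith

/-- Passing to `dyadicSin`, decorrelating there and passing back. The cutoff `2 ^ L` is free:
raising it amplifies `R` but, when `α + β < p`, shrinks the tail term. -/
theorem CharFunDecorrelated.integral_rpow_mul_rpow_le {Ω : Type*} [MeasurableSpace Ω]
    {μ : Measure Ω} [IsProbabilityMeasure μ] {X Y : Ω → ℝ} {R : ℝ} {j : ℕ}
    (h : CharFunDecorrelated μ X Y (2 * j) R) {α β p : ℝ} (hα : 1 ≤ α) (hβ : 1 ≤ β)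
    (hp : α + β ≤ p) (hαj : α + 1 ≤ 2 * j) (hβj : β + 1 ≤ 2 * j)
    (hX : MemLp X (ENNReal.ofReal p) μ) (hY : MemLp Y (ENNReal.ofReal p) μ) (L : ℕ) :
    ∫ ω, |X ω| ^ α * |Y ω| ^ β ∂μ ≤
      ((8 / 3) ^ (2 * j)) ^ 2 * ((1 + 4 * ∫ ω, |X ω| ^ α ∂μ) * (1 + 4 * ∫ ω, |Y ω| ^ β ∂μ)
          + (2 ^ L : ℝ) ^ (α + β + 2) * R)
        + (2 ^ L : ℝ) ^ (α + β - p) * (∫ ω, |X ω| ^ p ∂μ + ∫ ω, |Y ω| ^ p ∂μ) := by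
  have hXm := hX.aestronglyMeasurable.aemeasurable
  have hYm := hY.aestronglyMeasurable.aemeasurable
  have iX := integrable_dyadicSin hXm α j L
  have iY := integrable_dyadicSin hYm β j L
  obtain ⟨iXY, hXY⟩ := h.dyadicSin hXm hYm (zero_le_one.trans hα) (zero_le_one.trans hβ) L
  have pX := hX.integrable_abs_rpow (by linarith : 0 < p) le_rfl
  have pY := hY.integrable_abs_rpow (by linarith : 0 < p) le_rfl
  have bX : ∫ ω, _root_.dyadicSin α j L (X ω) ∂μ ≤ 4 * ∫ ω, |X ω| ^ α ∂μ := by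
    rw [← integral_const_mul]
    exact integral_mono iX ((hX.integrable_abs_rpow (by linarith) (by linarith)).const_mul 4)
      fun ω => dyadicSin_le hα hαj L _
  have bY : ∫ ω, _root_.dyadicSin β j L (Y ω) ∂μ ≤ 4 * ∫ ω, |Y ω| ^ β ∂μ := by
    rw [← integral_const_mul]
    exact integral_mono iY ((hY.integrable_abs_rpow (by linarith) (by linarith)).const_mul 4)
      fun ω => dyadicSin_le hβ hβj L _
  have nX : 0 ≤ ∫ ω, _root_.dyadicSin α j L (X ω) ∂μ :=
    integral_nonneg fun ω => dyadicSin_nonneg _ _ _ _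
  have nY : 0 ≤ ∫ ω, _root_.dyadicSin β j L (Y ω) ∂μ :=
    integral_nonneg fun ω => dyadicSin_nonneg _ _ _ _
  have ex : ∀ ω, (1 + _root_.dyadicSin α j L (X ω)) * (1 + _root_.dyadicSin β j L (Y ω))
      = 1 + _root_.dyadicSin α j L (X ω) + _root_.dyadicSin β j L (Y ω)
        + _root_.dyadicSin α j L (X ω) * _root_.dyadicSin β j L (Y ω) := fun ω => by ring
  have i1 := (integrable_const (μ := μ) (1 : ℝ)).fun_add iX
  have i2 := i1.fun_add iY
  have i3 := i2.fun_add iXY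
  have e3 : ∫ ω, (1 + _root_.dyadicSin α j L (X ω)) * (1 + _root_.dyadicSin β j L (Y ω)) ∂μ
      = 1 + (∫ ω, _root_.dyadicSin α j L (X ω) ∂μ) + (∫ ω, _root_.dyadicSin β j L (Y ω) ∂μ)
        + ∫ ω, _root_.dyadicSin α j L (X ω) * _root_.dyadicSin β j L (Y ω) ∂μ := by
    simp only [ex]
    rw [integral_add i2 iXY, integral_add i1 iY, integral_add (integrable_const _) iX]
    simp
  have i3' : Integrable (fun ω =>
      (1 + _root_.dyadicSin α j L (X ω)) * (1 + _root_.dyadicSin β j L (Y ω))) μ := by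
    simp only [ex]; exact i3
  calc ∫ ω, |X ω| ^ α * |Y ω| ^ β ∂μ
      ≤ ∫ ω, (((8 / 3) ^ (2 * j)) ^ 2
          * ((1 + _root_.dyadicSin α j L (X ω)) * (1 + _root_.dyadicSin β j L (Y ω)))
        + (2 ^ L : ℝ) ^ (α + β - p) * (|X ω| ^ p + |Y ω| ^ p)) ∂μ :=
        integral_mono_of_nonneg (Filter.Eventually.of_forall fun ω => by positivity)
          ((i3'.const_mul _).fun_add ((pX.fun_add pY).const_mul _))
          (Filter.Eventually.of_forall fun ω => rpow_mul_rpow_le_dyadicSin (by linarith)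
            (by linarith) hp j L _ _)
    _ = ((8 / 3) ^ (2 * j)) ^ 2 * (∫ ω,
          (1 + _root_.dyadicSin α j L (X ω)) * (1 + _root_.dyadicSin β j L (Y ω)) ∂μ)
        + (2 ^ L : ℝ) ^ (α + β - p) * (∫ ω, |X ω| ^ p ∂μ + ∫ ω, |Y ω| ^ p ∂μ) := by
        rw [integral_add (i3'.const_mul _) ((pX.fun_add pY).const_mul _), integral_const_mul,
          integral_const_mul, integral_add pX pY]
    _ ≤ _ := by
        gcongr
        rw [e3]
        calc _ ≤ (1 + ∫ ω, _root_.dyadicSin α j L (X ω) ∂μ)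
              * (1 + ∫ ω, _root_.dyadicSin β j L (Y ω) ∂μ) + (2 ^ L : ℝ) ^ (α + β + 2) * R := by
              linarith
          _ ≤ _ := by gcongr

theorem integral_abs_add_rpow_le {Ω : Type*} [MeasurableSpace Ω] {μ : Measure Ω}
    [IsProbabilityMeasure μ] {X Y : Ω → ℝ} {q : ℝ} (hq : 1 ≤ q)
    (hX : MemLp X (ENNReal.ofReal q) μ) (hY : MemLp Y (ENNReal.ofReal q) μ) :
    ∫ ω, |X ω + Y ω| ^ q ∂μ ≤ ∫ ω, |X ω| ^ q ∂μ + ∫ ω, |Y ω| ^ q ∂μ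
      + 2 ^ q * (∫ ω, |X ω| ^ (q - 1) * |Y ω| ^ (1 : ℝ) ∂μ
        + ∫ ω, |Y ω| ^ (q - 1) * |X ω| ^ (1 : ℝ) ∂μ) := by
  have pX := hX.integrable_abs_rpow (by linarith : 0 < q) le_rfl
  have pY := hY.integrable_abs_rpow (by linarith : 0 < q) le_rfl
  have iXY := integrable_rpow_mul_rpow hX hY (sub_nonneg.2 hq) zero_le_one (by linarith)
    (by linarith)
  have iYX := integrable_rpow_mul_rpow hY hX (sub_nonneg.2 hq) zero_le_one (by linarith)
    (by linarith)
  calc _ ≤ ∫ ω, (|X ω| ^ q + |Y ω| ^ q + 2 ^ q * (|X ω| ^ (q - 1) * |Y ω| ^ (1 : ℝ)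
        + |Y ω| ^ (q - 1) * |X ω| ^ (1 : ℝ))) ∂μ := by
        refine integral_mono_of_nonneg (Filter.Eventually.of_forall fun ω => by positivity)
          ((pX.fun_add pY).fun_add ((iXY.fun_add iYX).const_mul _))
          (Filter.Eventually.of_forall fun ω => ?_)
        simp only [Real.rpow_one]
        exact abs_add_rpow_le hq _ _
    _ = _ := by
        rw [integral_add (pX.fun_add pY) ((iXY.fun_add iYX).const_mul _), integral_add pX pY,
          integral_const_mul, integral_add iXY iYX]

theorem integral_abs_rpow_le_of_le {Ω : Type*} [MeasurableSpace Ω] {μ : Measure Ω}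
    [IsProbabilityMeasure μ] {X : Ω → ℝ} {q r M : ℝ} (hX : MemLp X (ENNReal.ofReal q) μ)
    (hr : 0 < r) (hrq : r ≤ q) (hM : 0 ≤ M) (h : ∫ ω, |X ω| ^ q ∂μ ≤ M ^ q) :
    ∫ ω, |X ω| ^ r ∂μ ≤ M ^ r := by
  have hrq' := ENNReal.ofReal_le_ofReal hrq
  rw [← eLpNorm_ofReal_le_iff hr (hX.mono_exponent hrq') hM]
  exact (eLpNorm_le_eLpNorm_of_exponent_le hrq' hX.aestronglyMeasurable).trans
    ((eLpNorm_ofReal_le_iff (hr.trans_le hrq) hX hM).2 h)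

theorem CharFunDecorrelated.symm {Ω : Type*} [MeasurableSpace Ω] {μ : Measure Ω}
    {X Y : Ω → ℝ} {ε R : ℝ} (h : CharFunDecorrelated μ X Y ε R) :
    CharFunDecorrelated μ Y X ε R := by
  intro s t hs ht
  have := h t s ht hs
  simp only [add_comm (s * Y _)]
  rwa [mul_comm (∫ ω, Complex.exp (Complex.I * (s * Y ω : ℝ)) ∂μ)]

/-! ### Block sums: decay of correlations and the second moment. -/

/-- The sum of `n` consecutive terms of the process `a`, starting with the `m`-th. -/
def blockSum {Ω : Type*} (a : ℕ → Ω → ℝ) (m n : ℕ) (ω : Ω) : ℝ :=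
  ∑ ℓ ∈ Finset.Ico m (m + n), a ℓ ω

/-- A real centered process, bounded by `K` in `L^p`, for which two blocks of length at most `N`
separated by a gap `k` have almost decorrelated characteristic functions. -/
structure IsDecorrelatedProcess {Ω : Type*} [MeasurableSpace Ω] (μ : Measure Ω) (a : ℕ → Ω → ℝ)
    (p K ε C r c : ℝ) : Prop where
  memLp : ∀ ℓ, MemLp (a ℓ) (ENNReal.ofReal p) μ
  eLpNorm_le : ∀ ℓ, eLpNorm (a ℓ) (ENNReal.ofReal p) μ ≤ ENNReal.ofReal K
  integral_eq_zero : ∀ ℓ, ∫ ω, a ℓ ω ∂μ = 0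
  decorrelated : ∀ N m n n' k : ℕ, 0 < n → 0 < n' → 0 < k → n ≤ N → n' ≤ N →
    CharFunDecorrelated μ (blockSum a m n) (blockSum a (m + n + k) n') ε
      (C * (1 + N : ℝ) ^ r * Real.exp (-(c * k)))

theorem blockSum_add {Ω : Type*} (a : ℕ → Ω → ℝ) (m n n' : ℕ) :
    blockSum a m (n + n') = blockSum a m n + blockSum a (m + n) n' := by
  funext ω
  simp only [blockSum, Pi.add_apply]
  rw [← add_assoc, Finset.sum_Ico_consecutive _ (by omega) (by omega)]

namespace IsDecorrelatedProcess

variable {Ω : Type*} [MeasurableSpace Ω] {μ : Measure Ω} {a : ℕ → Ω → ℝ} {p K ε C r c : ℝ}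

theorem memLp_blockSum (h : IsDecorrelatedProcess μ a p K ε C r c) (m n : ℕ) :
    MemLp (blockSum a m n) (ENNReal.ofReal p) μ :=
  memLp_finsetSum _ fun ℓ _ => h.memLp ℓ

variable [IsProbabilityMeasure μ]

theorem eLpNorm_blockSum_le (h : IsDecorrelatedProcess μ a p K ε C r c) {q : ℝ} (hq : 1 ≤ q)
    (hqp : q ≤ p) (m n : ℕ) :
    eLpNorm (blockSum a m n) (ENNReal.ofReal q) μ ≤ ENNReal.ofReal (K * n) := by
  have hle := ENNReal.ofReal_le_ofReal hqp
  have e : blockSum a m n = ∑ ℓ ∈ Finset.Ico m (m + n), a ℓ := by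
    funext ω; simp [blockSum]
  rw [e]
  calc _ ≤ ∑ ℓ ∈ Finset.Ico m (m + n), eLpNorm (a ℓ) (ENNReal.ofReal q) μ :=
        eLpNorm_sum_le (fun ℓ _ => (h.memLp ℓ).aestronglyMeasurable)
          (by rwa [ENNReal.one_le_ofReal])
    _ ≤ ∑ ℓ ∈ Finset.Ico m (m + n), ENNReal.ofReal K := Finset.sum_le_sum fun ℓ _ =>
        (eLpNorm_le_eLpNorm_of_exponent_le hle (h.memLp ℓ).aestronglyMeasurable).trans
          (h.eLpNorm_le ℓ)
    _ = _ := by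
        rw [Finset.sum_const, Nat.card_Ico, nsmul_eq_mul, mul_comm K,
          ENNReal.ofReal_mul (by positivity), ENNReal.ofReal_natCast]
        simp

theorem exists_abs_integral_mul_le (h : IsDecorrelatedProcess μ a p K ε C r c) (hp : 2 < p)
    (hK : 0 ≤ K) (hε : 1 ≤ ε) (hC : 0 ≤ C) (hc : 0 < c) :
    ∃ B ρ : ℝ, 0 ≤ B ∧ 0 ≤ ρ ∧ ρ < 1 ∧
      ∀ i j, |∫ ω, a i ω * a j ω ∂μ| ≤ B * ρ ^ Nat.dist i j := by
  obtain ⟨γ, hγ0, hγ1, hγp⟩ : ∃ γ : ℝ, 0 < γ ∧ γ ≤ 1 ∧ 2 + γ ≤ p :=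
    ⟨min 1 (p - 2), by simp [hp], min_le_left _ _, by linarith [min_le_right 1 (p - 2)]⟩
  have hγ' := ENNReal.ofReal_le_ofReal hγp
  have hmem : ∀ ℓ, MemLp (a ℓ) (ENNReal.ofReal (2 + γ)) μ := fun ℓ =>
    (h.memLp ℓ).mono_exponent hγ'
  set M := K ^ (2 + γ) with hM
  have hM0 : 0 ≤ M := by positivity
  have hmom : ∀ ℓ, ∫ ω, |a ℓ ω| ^ (2 + γ) ∂μ ≤ M := fun ℓ =>
    (eLpNorm_ofReal_le_iff (by linarith) (hmem ℓ) hK).1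
      ((eLpNorm_le_eLpNorm_of_exponent_le hγ' (h.memLp ℓ).aestronglyMeasurable).trans
        (h.eLpNorm_le ℓ))
  set ρ := Real.exp (-(c * γ / 4)) with hρ
  have hρ0 : 0 < ρ := Real.exp_pos _
  have hρ1 : ρ < 1 := by rw [hρ, Real.exp_lt_one_iff]; nlinarith [mul_pos hc hγ0]
  have single : ∀ i, blockSum a i 1 = a i := fun i => by funext ω; simp [blockSum]
  have near : ∀ i j, |∫ ω, a i ω * a j ω ∂μ| ≤ 2 * (1 + M) := by
    intro i j
    have hi := (hmem i).integrable_abs_rpow (by linarith : 0 < 2 + γ) le_rfl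
    have hj := (hmem j).integrable_abs_rpow (by linarith : 0 < 2 + γ) le_rfl
    have sq_le : ∀ x : ℝ, x ^ 2 ≤ 1 + |x| ^ (2 + γ) := by
      intro x
      have : 0 ≤ |x| ^ (2 + γ) := by positivity
      rw [← sq_abs]
      rcases le_total |x| 1 with hx | hx
      · linarith [pow_le_one₀ (abs_nonneg x) hx (n := 2)]
      · have h2 := Real.rpow_le_rpow_of_exponent_le hx (by linarith : (2 : ℝ) ≤ 2 + γ)
        rw [Real.rpow_ofNat] at h2
        linarith
    calc |∫ ω, a i ω * a j ω ∂μ| = ‖∫ ω, a i ω * a j ω ∂μ‖ := rfl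
      _ ≤ ∫ ω, (2 + |a i ω| ^ (2 + γ) + |a j ω| ^ (2 + γ)) ∂μ := by
          refine norm_integral_le_of_norm_le (((integrable_const _).fun_add hi).fun_add hj)
            (Filter.Eventually.of_forall fun ω => ?_)
          have h1 := sq_le (a i ω)
          have h2 := sq_le (a j ω)
          rw [Real.norm_eq_abs, abs_mul]
          nlinarith [sq_nonneg (|a i ω| - |a j ω|), sq_abs (a i ω), sq_abs (a j ω),
            mul_nonneg (abs_nonneg (a i ω)) (abs_nonneg (a j ω))]
      _ = 2 + ∫ ω, |a i ω| ^ (2 + γ) ∂μ + ∫ ω, |a j ω| ^ (2 + γ) ∂μ := by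
          rw [integral_add ((integrable_const _).fun_add hi) hj,
            integral_add (integrable_const _) hi]
          simp
      _ ≤ _ := by linarith [hmom i, hmom j]
  set B' := C * 2 ^ r + 12 * (1 + M) ^ 2 with hB'
  have hB'0 : 0 ≤ B' := by positivity
  have far : ∀ i k : ℕ, 0 < k → |∫ ω, a i ω * a (i + 1 + k) ω ∂μ| ≤ B' * ρ ^ k := by
    intro i k hk
    have hd := h.decorrelated 1 i 1 1 k one_pos one_pos hk le_rfl le_rfl
    rw [single, single] at hd
    -- The scale is `s = exp (-c k / 4)`: then `R / s ^ 2` is of order `exp (-c k / 2)` and `s ^ γ =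
    -- ρ ^ k`, so both decay at least like `ρ ^ k`.
    have hs1 : Real.exp (-(c * k / 4)) ≤ 1 := by
      rw [Real.exp_le_one_iff]; have : 0 ≤ c * k / 4 := by positivity
      linarith
    refine (hd.abs_integral_mul_le hγ0 hγ1 (hmem _) (hmem _) (h.integral_eq_zero _)
      (h.integral_eq_zero _) (hmom _) (hmom _) (Real.exp_pos (-(c * k / 4))) hs1
      (hs1.trans hε)).trans ?_
    have e1 : Real.exp (-(c * k / 4)) ^ γ = ρ ^ k := by
      rw [← Real.exp_mul, hρ, ← Real.exp_nat_mul]; ring_nf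
    have e2 : Real.exp (-(c * k)) / Real.exp (-(c * k / 4)) ^ 2 ≤ ρ ^ k := by
      rw [← e1, ← Real.exp_nat_mul, ← Real.exp_sub, ← Real.exp_mul, Real.exp_le_exp]
      have : 0 ≤ c * k := by positivity
      push_cast
      nlinarith
    rw [e1, mul_div_assoc, hB', add_mul]
    norm_num
    gcongr
  -- A gap `k` between single terms means distance `k + 1`; dividing by `ρ` pays for this shift and
  -- covers distances `0` and `1`.
  refine ⟨(2 * (1 + M) + B') / ρ, ρ, by positivity, hρ0.le, hρ1, ?_⟩
  have key : ∀ i l : ℕ, |∫ ω, a i ω * a (i + l) ω ∂μ| ≤ (2 * (1 + M) + B') / ρ * ρ ^ l := by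
    intro i l
    have h1 : 0 ≤ 2 * (1 + M) := by positivity
    rcases l with _ | _ | k
    · refine (near _ _).trans ?_
      rw [pow_zero, mul_one, le_div_iff₀ hρ0]
      nlinarith
    · refine (near _ _).trans ?_
      rw [zero_add, pow_one, div_mul_cancel₀ _ hρ0.ne']
      linarith
    · have := far i (k + 1) k.succ_pos
      rw [show i + (k + 1 + 1) = i + 1 + (k + 1) by omega, pow_succ, mul_comm (ρ ^ _),
        ← mul_assoc, div_mul_cancel₀ _ hρ0.ne']
      refine this.trans ?_
      gcongr
      linarith
  intro i j
  rcases le_total i j with hij | hij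
  · obtain ⟨l, rfl⟩ := Nat.exists_eq_add_of_le hij
    rw [Nat.dist_eq_sub_of_le hij, Nat.add_sub_cancel_left]
    exact key i l
  · obtain ⟨l, rfl⟩ := Nat.exists_eq_add_of_le hij
    rw [Nat.dist_eq_sub_of_le_right hij, Nat.add_sub_cancel_left]
    simp only [mul_comm (a (j + l) _)]
    exact key j l

theorem exists_integral_sq_blockSum_le (h : IsDecorrelatedProcess μ a p K ε C r c) (hp : 2 < p)
    (hK : 0 ≤ K) (hε : 1 ≤ ε) (hC : 0 ≤ C) (hc : 0 < c) :
    ∃ B : ℝ, 0 ≤ B ∧ ∀ m n, ∫ ω, blockSum a m n ω ^ 2 ∂μ ≤ B * n := by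
  obtain ⟨B, ρ, hB, hρ0, hρ1, hcov⟩ := h.exists_abs_integral_mul_le hp hK hε hC hc
  have : 0 < 1 - ρ := by linarith
  refine ⟨B * (2 * (1 - ρ)⁻¹), by positivity, fun m n => ?_⟩
  have two_le : (2 : ℝ≥0∞) ≤ ENNReal.ofReal p := by
    rw [← ENNReal.ofReal_ofNat]; exact ENNReal.ofReal_le_ofReal hp.le
  have hint : ∀ i j, Integrable (fun ω => a i ω * a j ω) μ := fun i j =>
    ((h.memLp i).mono_exponent two_le).integrable_mul ((h.memLp j).mono_exponent two_le)
  have e : ∀ ω, blockSum a m n ω ^ 2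
      = ∑ i ∈ Finset.range n, ∑ j ∈ Finset.range n, a (m + i) ω * a (m + j) ω := by
    intro ω
    rw [blockSum, Finset.sum_Ico_eq_sum_range, Nat.add_sub_cancel_left, sq, Finset.sum_mul_sum]
  simp only [e]
  rw [integral_finsetSum _ fun i _ => integrable_finsetSum _ fun j _ => hint _ _]
  calc _ ≤ ∑ i ∈ Finset.range n, B * (2 * (1 - ρ)⁻¹) := by
        refine Finset.sum_le_sum fun i _ => ?_
        rw [integral_finsetSum _ fun j _ => hint _ _]
        calc _ ≤ ∑ j ∈ Finset.range n, B * ρ ^ Nat.dist i j := by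
              refine Finset.sum_le_sum fun j _ => ?_
              have := (le_abs_self _).trans (hcov (m + i) (m + j))
              rwa [Nat.dist_add_add_left] at this
          _ ≤ _ := by
              rw [← Finset.mul_sum]
              gcongr
              exact sum_range_pow_dist_le hρ0 hρ1 n i
    _ = _ := by rw [Finset.sum_const, Finset.card_range, nsmul_eq_mul, mul_comm]

theorem exists_integral_abs_blockSum_le (h : IsDecorrelatedProcess μ a p K ε C r c) (hp : 2 < p)
    (hK : 0 ≤ K) (hε : 1 ≤ ε) (hC : 0 ≤ C) (hc : 0 < c) :
    ∃ B : ℝ, 0 ≤ B ∧ ∀ m n, ∫ ω, |blockSum a m n ω| ^ (1 : ℝ) ∂μ ≤ B * √n := by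
  obtain ⟨B, hB, hsq⟩ := h.exists_integral_sq_blockSum_le hp hK hε hC hc
  refine ⟨√B, by positivity, fun m n => ?_⟩
  have h2 : MemLp (blockSum a m n) (ENNReal.ofReal 2) μ :=
    (h.memLp_blockSum m n).mono_exponent (ENNReal.ofReal_le_ofReal hp.le)
  have := integral_abs_rpow_le_of_le h2 one_pos one_le_two (M := √(B * n)) (by positivity) (by
    simp only [Real.rpow_ofNat, sq_abs]
    rw [Real.sq_sqrt (by positivity)]
    exact hsq m n)
  rwa [Real.rpow_one, Real.sqrt_mul hB] at this

theorem integral_abs_blockSum_rpow_le (h : IsDecorrelatedProcess μ a p K ε C r c) (hp : 1 ≤ p)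
    (hK : 0 ≤ K) {m n N : ℕ} (hn : n ≤ N) :
    ∫ ω, |blockSum a m n ω| ^ p ∂μ ≤ K ^ p * (1 + N : ℝ) ^ p := by
  rw [← Real.mul_rpow hK (by positivity),
    ← eLpNorm_ofReal_le_iff (by linarith) (h.memLp_blockSum m n) (by positivity)]
  refine (h.eLpNorm_blockSum_le hp le_rfl m n).trans (ENNReal.ofReal_le_ofReal ?_)
  have : (n : ℝ) ≤ N := by exact_mod_cast hn
  gcongr
  linarith

end IsDecorrelatedProcess

/-! ### Induction on the block length. -/

theorem exists_exp_le_two_pow {x : ℝ} (hx : 0 ≤ x) :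
    ∃ L : ℕ, Real.exp x ≤ 2 ^ L ∧ (2 : ℝ) ^ L ≤ 2 * Real.exp x := by
  obtain ⟨n, h1, h2⟩ := exists_nat_pow_near (Real.one_le_exp hx) (one_lt_two (α := ℝ))
  exact ⟨n + 1, h2.le, by rw [pow_succ]; linarith⟩

/-- A uniform version of `CharFunDecorrelated.integral_rpow_mul_rpow_le`, when the two variables
grow polynomially in `N` and the decorrelation is exponential in `√N`. -/
theorem exists_integral_rpow_mul_le {p q K C r c : ℝ} {j : ℕ} (hq : 2 < q) (hqp : q < p)
    (hj : q ≤ 2 * j) (hK : 0 ≤ K) (hC : 0 ≤ C) (hc : 0 < c) :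
    ∃ G : ℝ, 0 ≤ G ∧ ∀ {Ω : Type*} [MeasurableSpace Ω] (μ : Measure Ω) [IsProbabilityMeasure μ]
      (X Y : Ω → ℝ) (N : ℕ),
      MemLp X (ENNReal.ofReal p) μ → MemLp Y (ENNReal.ofReal p) μ →
      ∫ ω, |X ω| ^ p ∂μ ≤ K ^ p * (1 + N : ℝ) ^ p → ∫ ω, |Y ω| ^ p ∂μ ≤ K ^ p * (1 + N : ℝ) ^ p →
      CharFunDecorrelated μ X Y (2 * j)
        (C * (1 + N : ℝ) ^ r * Real.exp (-(c * (Nat.sqrt N : ℕ)))) →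
      ∫ ω, |X ω| ^ (q - 1) * |Y ω| ^ (1 : ℝ) ∂μ
        ≤ G * ((1 + ∫ ω, |X ω| ^ (q - 1) ∂μ) * (1 + ∫ ω, |Y ω| ^ (1 : ℝ) ∂μ) + 1) := by
  -- With `2 ^ L` of order `exp (δ k)`, the amplification `(2 ^ L) ^ (q + 2)` uses up only half of
  -- the decay `exp (-c k)`.
  set δ := c / (2 * (q + 2)) with hδ
  have hδ0 : 0 < δ := by positivity
  obtain ⟨B₁, hB₁, h1⟩ := exists_rpow_mul_exp_neg_sqrt_le r (half_pos hc)
  obtain ⟨B₂, hB₂, h2⟩ := exists_rpow_mul_exp_neg_sqrt_le p (mul_pos hδ0 (sub_pos.2 hqp))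
  set κ : ℝ := ((8 / 3) ^ (2 * j)) ^ 2 with hκ
  have hκ0 : 0 < κ := by positivity
  refine ⟨16 * κ + κ * (2 ^ (q + 2) * C * B₁) + 2 * K ^ p * B₂, by positivity, ?_⟩
  intro Ω _ μ _ X Y N hX hY hXp hYp hd
  set k := Nat.sqrt N with hk
  obtain ⟨L, hL1, hL2⟩ := exists_exp_le_two_pow (x := δ * k) (by positivity)
  have hmain := hd.integral_rpow_mul_rpow_le (α := q - 1) (β := 1) (by linarith) le_rfl
    (by linarith) (by linarith) (by linarith) hX hY L
  rw [sub_add_cancel] at hmain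
  set x := ∫ ω, |X ω| ^ (q - 1) ∂μ
  set y := ∫ ω, |Y ω| ^ (1 : ℝ) ∂μ
  have hx : 0 ≤ x := integral_nonneg fun ω => by positivity
  have hy : 0 ≤ y := integral_nonneg fun ω => by positivity
  have b1 : (2 ^ L : ℝ) ^ (q + 2) * (C * (1 + N : ℝ) ^ r * Real.exp (-(c * k)))
      ≤ 2 ^ (q + 2) * C * B₁ := by
    calc _ ≤ (2 * Real.exp (δ * k)) ^ (q + 2)
          * (C * (1 + N : ℝ) ^ r * Real.exp (-(c * k))) := by gcongr
      _ = 2 ^ (q + 2) * C * ((1 + N : ℝ) ^ r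
          * (Real.exp (δ * k * (q + 2)) * Real.exp (-(c * k)))) := by
          rw [Real.mul_rpow (by norm_num) (Real.exp_pos _).le, ← Real.exp_mul]; ring
      _ = 2 ^ (q + 2) * C * ((1 + N : ℝ) ^ r * Real.exp (-(c / 2 * k))) := by
          rw [← Real.exp_add]
          congr 3
          rw [hδ]; field_simp; ring
      _ ≤ _ := by gcongr; exact h1 N
  have b2 : (2 ^ L : ℝ) ^ (q - p) * (∫ ω, |X ω| ^ p ∂μ + ∫ ω, |Y ω| ^ p ∂μ)
      ≤ 2 * K ^ p * B₂ := by
    calc _ ≤ Real.exp (δ * k) ^ (q - p)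
          * (K ^ p * (1 + N : ℝ) ^ p + K ^ p * (1 + N : ℝ) ^ p) := by
          gcongr ?_ * (?_ + ?_)
          exact Real.rpow_le_rpow_of_nonpos (Real.exp_pos _) hL1 (by linarith)
      _ = 2 * K ^ p * ((1 + N : ℝ) ^ p * Real.exp (-(δ * (p - q) * k))) := by
          rw [← Real.exp_mul, show δ * k * (q - p) = -(δ * (p - q) * k) by ring]; ring
      _ ≤ _ := by gcongr; exact h2 N
  have b3 : (1 + 4 * x) * (1 + 4 * y) ≤ 16 * ((1 + x) * (1 + y)) := by nlinarith
  have hxy : 0 ≤ (1 + x) * (1 + y) := by positivity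
  have t1 : 0 ≤ κ * (2 ^ (q + 2) * C * B₁) := by positivity
  have t2 : 0 ≤ 2 * K ^ p * B₂ := by positivity
  calc _ ≤ κ * (16 * ((1 + x) * (1 + y)) + 2 ^ (q + 2) * C * B₁) + 2 * K ^ p * B₂ := by
        refine hmain.trans ?_
        gcongr
    _ ≤ _ := by nlinarith [mul_nonneg t1 hxy, mul_nonneg t2 hxy]

/-- The numerical step of the induction. -/
theorem rpow_recursion_le {q ρ G B D T x x₁ z z₁ w w' : ℝ} (hq : 1 ≤ q) (hG : 0 ≤ G)
    (hD : 1 ≤ D) (hT : 1 ≤ T) (hDρ : 2 ^ (q + 1) * G * (3 + 2 * B) ≤ (1 - ρ) / 2 * D)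
    (hx : x ≤ ρ / 2 * (D * T) ^ q) (hz : z ≤ ρ / 2 * (D * T) ^ q)
    (hx₁ : x₁ ≤ (D * T) ^ (q - 1)) (hz₁ : z₁ ≤ (D * T) ^ (q - 1))
    {u v : ℝ} (hu : 0 ≤ u) (hv : 0 ≤ v) (huB : u ≤ B * T) (hvB : v ≤ B * T)
    (hx₁0 : 0 ≤ x₁) (hz₁0 : 0 ≤ z₁)
    (hw : w ≤ G * ((1 + x₁) * (1 + v) + 1)) (hw' : w' ≤ G * ((1 + z₁) * (1 + u) + 1)) :
    x + z + 2 ^ q * (w + w') ≤ (1 + ρ) / 2 * (D * T) ^ q := by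
  have hDT : 1 ≤ D * T := one_le_mul_of_one_le_of_one_le hD hT
  have hP : 1 ≤ (D * T) ^ (q - 1) := Real.one_le_rpow hDT (by linarith)
  set P := (D * T) ^ (q - 1) with hPdef
  have hpow : (D * T) ^ q = P * (D * T) := by
    rw [hPdef, ← Real.rpow_add_one (by positivity), sub_add_cancel]
  have hcross : ∀ s t : ℝ, 0 ≤ s → 0 ≤ t → s ≤ P → t ≤ B * T →
      G * ((1 + s) * (1 + t) + 1) ≤ G * ((3 + 2 * B) * (P * T)) := by
    intro s t hs ht hsP htB
    have h1 : (1 + s) * (1 + t) ≤ (2 * P) * ((1 + B) * T) := by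
      gcongr
      · linarith
      · linarith
    have h2 : 1 ≤ P * T := one_le_mul_of_one_le_of_one_le hP hT
    gcongr
    linarith
  have c1 := hcross x₁ v hx₁0 hv hx₁ hvB
  have c2 := hcross z₁ u hz₁0 hu hz₁ huB
  have hPT : 0 ≤ P * T := by positivity
  have h2q : (2 : ℝ) ^ (q + 1) = 2 ^ q * 2 := Real.rpow_add_one (by norm_num) q
  calc x + z + 2 ^ q * (w + w')
      ≤ ρ / 2 * (D * T) ^ q + ρ / 2 * (D * T) ^ q
        + 2 ^ q * (G * ((3 + 2 * B) * (P * T)) + G * ((3 + 2 * B) * (P * T))) := by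
        gcongr <;> linarith
    _ = ρ * (D * T) ^ q + (2 ^ (q + 1) * G * (3 + 2 * B)) * (P * T) := by rw [h2q]; ring
    -- The cross terms lack one factor `D`, which the largeness of `D` supplies.
    _ ≤ ρ * (D * T) ^ q + ((1 - ρ) / 2 * D) * (P * T) := by gcongr
    _ = _ := by rw [hpow]; ring

theorem IsDecorrelatedProcess.exists_eLpNorm_blockSum_le {Ω : Type*} [MeasurableSpace Ω]
    {μ : Measure Ω} [IsProbabilityMeasure μ] {a : ℕ → Ω → ℝ} {p q K C r c : ℝ} {j : ℕ}
    (h : IsDecorrelatedProcess μ a p K (2 * j) C r c) (hq : 2 < q) (hqp : q < p)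
    (hj : q ≤ 2 * j) (hK : 0 ≤ K) (hC : 0 ≤ C) (hc : 0 < c) :
    ∃ D : ℝ, 0 < D ∧ ∀ n m,
      eLpNorm (blockSum a m n) (ENNReal.ofReal q) μ ≤ ENNReal.ofReal (D * √n) := by
  obtain ⟨B, hB, hL1⟩ := h.exists_integral_abs_blockSum_le (by linarith) hK (by linarith) hC hc
  obtain ⟨G, hG, hdec⟩ := exists_integral_rpow_mul_le (r := r) hq hqp hj hK hC hc
  set ρ : ℝ := 2 * (1 / √2) ^ q with hρ
  have hρ1 : ρ < 1 := by
    have h2 : (1 / √2 : ℝ) ^ q < (1 / √2) ^ (2 : ℝ) :=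
      Real.rpow_lt_rpow_of_exponent_gt (by positivity)
        (by rw [div_lt_one (by positivity), Real.lt_sqrt] <;> norm_num) hq
    rw [Real.rpow_ofNat, div_pow, Real.sq_sqrt (by norm_num)] at h2
    rw [hρ]; linarith
  have hρ0 : 0 < ρ := by positivity
  -- Half of the margin `1 - ρ` absorbs the cross terms; `σ < 1` is the resulting contraction in
  -- norm, which leaves room for the gap.
  set σ : ℝ := ((1 + ρ) / 2) ^ (1 / q) with hσ
  have hσ0 : 0 < σ := by positivity
  have hσ1 : σ < 1 := Real.rpow_lt_one (by positivity) (by linarith) (by positivity)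
  have hσq : σ ^ q = (1 + ρ) / 2 := by
    rw [hσ, ← Real.rpow_mul (by positivity), one_div_mul_cancel (by linarith), Real.rpow_one]
  set H : ℝ := 2 ^ (q + 1) * G * (3 + 2 * B) with hH
  have hH0 : 0 ≤ H := by positivity
  have h1ρ : 0 < 1 - ρ := by linarith
  have h1σ : 0 < 1 - σ := by linarith
  -- The last three conditions serve, in order, the blocks with `N < 4`, the cross terms and the
  -- gap.
  obtain ⟨D, hD1, hD2, hD3, hD4⟩ : ∃ D : ℝ, 1 ≤ D ∧ 2 * K ≤ D ∧ H ≤ (1 - ρ) / 2 * D ∧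
      K ≤ (1 - σ) * D := by
    have a1 : 0 ≤ 2 * H / (1 - ρ) := by positivity
    have a2 : 0 ≤ K / (1 - σ) := by positivity
    refine ⟨1 + 2 * K + 2 * H / (1 - ρ) + K / (1 - σ), by linarith, by linarith, ?_, ?_⟩
    · calc H = (1 - ρ) / 2 * (2 * H / (1 - ρ)) := by field_simp
        _ ≤ _ := by gcongr; linarith
    · calc K = (1 - σ) * (K / (1 - σ)) := by field_simp
        _ ≤ _ := by gcongr; linarith
  refine ⟨D, by linarith, fun N => ?_⟩
  induction N using Nat.strong_induction_on with
  | _ N ih =>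
  intro m
  have hmem : ∀ m n, MemLp (blockSum a m n) (ENNReal.ofReal q) μ := fun m n =>
    (h.memLp_blockSum m n).mono_exponent (ENNReal.ofReal_le_ofReal hqp.le)
  rcases lt_or_ge N 4 with hN | hN
  · refine (h.eLpNorm_blockSum_le (by linarith) hqp.le m N).trans (ENNReal.ofReal_le_ofReal ?_)
    have hs : √(N : ℝ) ≤ 2 := by
      rw [Real.sqrt_le_left (by norm_num)]
      have : (N : ℝ) ≤ 4 := by exact_mod_cast hN.le
      linarith
    have h0 := Real.sqrt_nonneg (N : ℝ)
    calc K * N = K * (√N * √N) := by rw [Real.mul_self_sqrt (by positivity)]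
      _ ≤ K * (2 * √N) := by gcongr
      _ = 2 * K * √N := by ring
      _ ≤ _ := by gcongr
  · set k := Nat.sqrt N with hk
    have hk0 : 2 ≤ k := by rw [hk, Nat.le_sqrt]; omega
    have hkk : k * k ≤ N := Nat.sqrt_le N
    have hkN : 2 * k ≤ N := by nlinarith
    -- Even with rounding up, the longer half has length at most `N / 2`, because the gap removes at
    -- least one term.
    obtain ⟨n, n', hn0, hn'0, hn, hn', hsum⟩ : ∃ n n' : ℕ, 0 < n ∧ 0 < n' ∧ 2 * n ≤ N ∧
        2 * n' ≤ N ∧ N = n + k + n' :=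
      ⟨(N - k) / 2, N - k - (N - k) / 2, by omega, by omega, by omega, by omega, by omega⟩
    set X := blockSum a m n
    set Y := blockSum a (m + n + k) n'
    set T := √(N : ℝ) with hT
    have hT1 : 1 ≤ T := by
      rw [hT, Real.one_le_sqrt]; exact_mod_cast (by omega : 1 ≤ N)
    have hkT : (k : ℝ) ≤ T := by
      rw [hT]; apply Real.le_sqrt_of_sq_le; rw [sq]; exact_mod_cast hkk
    have hsplit : blockSum a m N = (X + Y) + blockSum a (m + n) k := by
      rw [hsum, blockSum_add, blockSum_add, ← add_assoc m n k]
      abel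
    have hhalf : ∀ l : ℕ, 2 * l ≤ N → √(l : ℝ) ≤ 1 / √2 * T := by
      intro l hl
      rw [one_div, ← Real.sqrt_inv, hT, ← Real.sqrt_mul (by norm_num)]
      apply Real.sqrt_le_sqrt
      have : (2 * l : ℝ) ≤ N := by exact_mod_cast hl
      linarith
    have hmom : ∀ l i : ℕ, 2 * l ≤ N → ∫ ω, |blockSum a i l ω| ^ q ∂μ
        ≤ (D * (1 / √2 * T)) ^ q := by
      intro l i hl
      rw [← eLpNorm_ofReal_le_iff (by linarith) (hmem i l) (by positivity)]
      refine (ih l (by omega) i).trans (ENNReal.ofReal_le_ofReal ?_)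
      gcongr
      exact hhalf l hl
    have hmomq : ∀ l i : ℕ, 2 * l ≤ N → ∫ ω, |blockSum a i l ω| ^ q ∂μ
        ≤ ρ / 2 * (D * T) ^ q := by
      intro l i hl
      refine (hmom l i hl).trans (le_of_eq ?_)
      rw [mul_left_comm, Real.mul_rpow (by positivity) (by positivity), hρ]
      ring
    have hmomq1 : ∀ l i : ℕ, 2 * l ≤ N → ∫ ω, |blockSum a i l ω| ^ (q - 1) ∂μ
        ≤ (D * T) ^ (q - 1) := by
      intro l i hl
      refine (integral_abs_rpow_le_of_le (hmem i l) (by linarith) (by linarith) (by positivity)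
        (hmom l i hl)).trans ?_
      have : 1 / √2 ≤ (1 : ℝ) := by
        rw [div_le_one (by positivity), Real.one_le_sqrt]; norm_num
      have h4 : 1 / √2 * T ≤ T := mul_le_of_le_one_left (by linarith) this
      apply Real.rpow_le_rpow (by positivity) _ (by linarith)
      gcongr
    have hmom1 : ∀ l i : ℕ, 2 * l ≤ N → ∫ ω, |blockSum a i l ω| ^ (1 : ℝ) ∂μ ≤ B * T := by
      intro l i hl
      refine (hL1 i l).trans ?_
      gcongr
      exact Real.sqrt_le_sqrt (by exact_mod_cast (by omega : l ≤ N))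
    have hmomp : ∀ l i : ℕ, 2 * l ≤ N → ∫ ω, |blockSum a i l ω| ^ p ∂μ
        ≤ K ^ p * (1 + N : ℝ) ^ p := fun l i hl =>
      h.integral_abs_blockSum_rpow_le (by linarith) hK (by omega)
    have nonneg : ∀ (l i : ℕ) (s : ℝ), 0 ≤ ∫ ω, |blockSum a i l ω| ^ s ∂μ := fun l i s =>
      integral_nonneg fun ω => by positivity
    have hXY := h.decorrelated N m n n' k hn0 hn'0 (by omega) (by omega) (by omega)
    have cXY := hdec μ X Y N (h.memLp_blockSum _ _) (h.memLp_blockSum _ _) (hmomp _ _ hn)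
      (hmomp _ _ hn') hXY
    have cYX := hdec μ Y X N (h.memLp_blockSum _ _) (h.memLp_blockSum _ _) (hmomp _ _ hn')
      (hmomp _ _ hn) hXY.symm
    have hXYq : ∫ ω, |(X + Y) ω| ^ q ∂μ ≤ (σ * (D * T)) ^ q := by
      rw [Real.mul_rpow hσ0.le (by positivity), hσq]
      exact (integral_abs_add_rpow_le (by linarith) (hmem _ _) (hmem _ _)).trans
        (rpow_recursion_le (by linarith) hG hD1 hT1 hD3 (hmomq _ _ hn) (hmomq _ _ hn')
          (hmomq1 _ _ hn) (hmomq1 _ _ hn') (nonneg _ _ _) (nonneg _ _ _) (hmom1 _ _ hn)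
          (hmom1 _ _ hn') (nonneg _ _ _) (nonneg _ _ _) cXY cYX)
    have hnorm := (eLpNorm_ofReal_le_iff (by linarith) ((hmem _ _).add (hmem _ _))
      (by positivity)).2 hXYq
    rw [hsplit]
    calc _ ≤ eLpNorm (X + Y) (ENNReal.ofReal q) μ
          + eLpNorm (blockSum a (m + n) k) (ENNReal.ofReal q) μ :=
          eLpNorm_add_le ((hmem _ _).add (hmem _ _)).aestronglyMeasurable
            (hmem _ _).aestronglyMeasurable (by rw [ENNReal.one_le_ofReal]; linarith)
      _ ≤ ENNReal.ofReal (σ * (D * T)) + ENNReal.ofReal (K * k) :=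
          add_le_add hnorm (h.eLpNorm_blockSum_le (by linarith) hqp.le _ _)
      _ = ENNReal.ofReal (σ * (D * T) + K * k) :=
          (ENNReal.ofReal_add (by positivity) (by positivity)).symm
      _ ≤ _ := by
          apply ENNReal.ofReal_le_ofReal
          have : K * k ≤ (1 - σ) * D * T := by gcongr
          linarith

/-! ### Reduction to real coordinates. -/

theorem EuclideanSpace.norm_le_sum_abs {d : ℕ} (v : EuclideanSpace ℝ (Fin d)) :
    ‖v‖ ≤ ∑ i, |v i| := by
  rw [EuclideanSpace.norm_eq]
  refine Real.sqrt_le_iff.2 ⟨Finset.sum_nonneg fun i _ => abs_nonneg _, ?_⟩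
  simp only [Real.norm_eq_abs]
  exact Finset.sum_sq_le_sq_sum_of_nonneg fun i _ => abs_nonneg _

theorem blockSum_mul_coord {Ω : Type*} {d : ℕ} (A : ℕ → Ω → EuclideanSpace ℝ (Fin d))
    (θ : ℝ) (i : Fin d) (m n : ℕ) (ω : Ω) :
    blockSum (fun ℓ ω => θ * A ℓ ω i) m n ω
      = θ * (∑ ℓ ∈ Finset.Ico m (m + n), A ℓ ω) i := by
  simp [blockSum, Finset.mul_sum]

/-- Only the case of one block on each side of the gap is needed, with frequencies along the `i`-th
basis vector. -/
theorem charFunDecorrelated_coord {Ω : Type*} [MeasurableSpace Ω] {μ : Measure Ω}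
    {d : ℕ} {A : ℕ → Ω → EuclideanSpace ℝ (Fin d)} {ε₀ C c : ℝ} (hC : 0 < C)
    (hH : ∀ n m k : ℕ, 0 < n → 0 < m → 0 < k →
      ∀ b : ℕ → ℕ, (∀ j < n + m, b j < b (j + 1)) →
      ∀ t : ℕ → EuclideanSpace ℝ (Fin d), (∀ j < n + m, ‖t j‖ ≤ ε₀) →
        ‖(∫ ω, Complex.exp (Complex.I * ((blockPhase A b t (Finset.range n) 0 ω
              + blockPhase A b t (Finset.Ico n (n + m)) k ω : ℝ) : ℂ)) ∂μ)
            - (∫ ω, Complex.exp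
                (Complex.I * ((blockPhase A b t (Finset.range n) 0 ω : ℝ) : ℂ)) ∂μ)
              * (∫ ω, Complex.exp
                (Complex.I * ((blockPhase A b t (Finset.Ico n (n + m)) k ω : ℝ) : ℂ)) ∂μ)‖
          ≤ C * (1 + (((Finset.range (n + m)).sup (fun j => b (j + 1) - b j) : ℕ) : ℝ))
                ^ (C * ((n : ℝ) + (m : ℝ)))
              * Real.exp (-(c * (k : ℝ))))
    {θ ε : ℝ} (hθ : 0 ≤ θ) (hε : θ * ε ≤ ε₀) (i : Fin d) {N m n n' k : ℕ}
    (hn : 0 < n) (hn' : 0 < n') (hk : 0 < k) (hnN : n ≤ N) (hn'N : n' ≤ N) :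
    CharFunDecorrelated μ (blockSum (fun ℓ ω => θ * A ℓ ω i) m n)
      (blockSum (fun ℓ ω => θ * A ℓ ω i) (m + n + k) n') ε
      (C * (1 + N : ℝ) ^ (C * 2) * Real.exp (-(c * k))) := by
  intro s t hs ht
  -- The blocks are adjacent here; the shift by `k` inside `blockPhase` creates the gap.
  set b : ℕ → ℕ := fun j => if j = 0 then m else if j = 1 then m + n else m + n + n' with hb
  set τ : ℕ → EuclideanSpace ℝ (Fin d) := fun j =>
    EuclideanSpace.single i (if j = 0 then θ * s else θ * t) with hτ
  have hnorm : ∀ s : ℝ, |s| ≤ ε → |θ * s| ≤ ε₀ := fun s hs => by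
    rw [abs_mul, abs_of_nonneg hθ]
    exact (mul_le_mul_of_nonneg_left hs hθ).trans hε
  have h := hH 1 1 k one_pos one_pos hk b
    (by intro j hj; interval_cases j <;> simp [hb, hn, hn'])
    τ (by
      intro j hj
      simp only [hτ, PiLp.norm_single, Real.norm_eq_abs]
      split_ifs
      exacts [hnorm s hs, hnorm t ht])
  have p1 : ∀ ω, blockPhase A b τ (Finset.range 1) 0 ω
      = s * blockSum (fun ℓ ω => θ * A ℓ ω i) m n ω := by
    intro ω
    rw [blockSum_mul_coord]
    simp [blockPhase, hb, hτ, EuclideanSpace.inner_single_left]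
    ring
  have p2 : ∀ ω, blockPhase A b τ (Finset.Ico 1 (1 + 1)) k ω
      = t * blockSum (fun ℓ ω => θ * A ℓ ω i) (m + n + k) n' ω := by
    intro ω
    rw [blockSum_mul_coord]
    simp [blockPhase, hb, hτ, EuclideanSpace.inner_single_left, add_right_comm (m + n) n' k]
    ring
  simp only [p1, p2] at h
  refine h.trans ?_
  have hsup : (Finset.range (1 + 1)).sup (fun j => b (j + 1) - b j) ≤ N := by
    refine Finset.sup_le fun j hj => ?_
    have hj : j < 2 := Finset.mem_range.1 hj
    interval_cases j <;> simp [hb, hnN, hn'N]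
  have hsup' : (((Finset.range (1 + 1)).sup (fun j => b (j + 1) - b j) : ℕ) : ℝ) ≤ N := by
    exact_mod_cast hsup
  have e : C * (((1 : ℕ) : ℝ) + ((1 : ℕ) : ℝ)) = C * 2 := by norm_num
  rw [e]
  gcongr

theorem exists_coord_bound {Ω : Type*} [MeasurableSpace Ω] {μ : Measure Ω}
    [IsProbabilityMeasure μ] {d : ℕ} {A : ℕ → Ω → EuclideanSpace ℝ (Fin d)} {p q : ℝ}
    (hq : 2 < q) (hqp : q < p) (hcent : IsCenteredProcess μ A)
    (hbdd : BoundedInLp μ A (ENNReal.ofReal p)) (hH : ConditionH μ A) (i : Fin d) :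
    ∃ D : ℝ, 0 < D ∧ ∀ m n : ℕ,
      eLpNorm (fun ω => (∑ ℓ ∈ Finset.Ico m (m + n), A ℓ ω) i) (ENNReal.ofReal q) μ
        ≤ ENNReal.ofReal (D * √n) := by
  obtain ⟨ε₀, C, c, hε₀, hC, hc, hH⟩ := hH
  obtain ⟨K, hK⟩ := hbdd
  obtain ⟨j, hj⟩ := exists_nat_ge (q / 2)
  have hj : q ≤ 2 * j := by linarith
  have hj0 : (0 : ℝ) < 2 * j := by linarith
  -- Rescaling the process turns the admissible range `ε₀` into `2 * j`, the largest frequency in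
  -- `sin ^ (2 * j)`.
  set θ := ε₀ / (2 * j) with hθ
  have hθ0 : 0 < θ := by positivity
  have hcoord : ∀ ℓ, MemLp (fun ω => A ℓ ω i) (ENNReal.ofReal p) μ := fun ℓ =>
    (EuclideanSpace.proj i : EuclideanSpace ℝ (Fin d) →L[ℝ] ℝ).comp_memLp' (hK ℓ).1
  have hproc : IsDecorrelatedProcess μ (fun ℓ ω => θ * A ℓ ω i) p (θ * K) (2 * j) C (C * 2) c :=
    { memLp := fun ℓ => (hcoord ℓ).const_mul θ
      eLpNorm_le := fun ℓ => by
        rw [ENNReal.ofReal_mul hθ0.le, ENNReal.ofReal_coe_nnreal]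
        refine (eLpNorm_le_mul_eLpNorm_of_ae_le_mul (g := A ℓ)
          (Filter.Eventually.of_forall fun ω => ?_) _).trans
          (mul_le_mul_right (hK ℓ).2 _)
        rw [norm_mul, Real.norm_of_nonneg hθ0.le]
        gcongr
        exact PiLp.norm_apply_le _ _
      integral_eq_zero := fun ℓ => by
        have h : ∫ ω, A ℓ ω i ∂μ = EuclideanSpace.proj (𝕜 := ℝ) i (∫ ω, A ℓ ω ∂μ) :=
          (EuclideanSpace.proj i : EuclideanSpace ℝ (Fin d) →L[ℝ] ℝ).integral_comp_comm
            (hcent ℓ).1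
        rw [integral_const_mul, h, (hcent ℓ).2, map_zero, mul_zero]
      decorrelated := fun N m n n' k hn hn' hk hnN hn'N =>
        charFunDecorrelated_coord hC hH hθ0.le
          (by rw [hθ, div_mul_cancel₀ _ hj0.ne']) i hn hn' hk hnN hn'N }
  obtain ⟨D, hD, hbound⟩ := hproc.exists_eLpNorm_blockSum_le hq hqp hj (by positivity) hC.le hc
  refine ⟨θ⁻¹ * D, by positivity, fun m n => ?_⟩
  rw [mul_assoc, ENNReal.ofReal_mul (by positivity)]
  refine (eLpNorm_le_mul_eLpNorm_of_ae_le_mul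
    (g := blockSum (fun ℓ ω => θ * A ℓ ω i) m n) (c := θ⁻¹)
    (Filter.Eventually.of_forall fun ω => ?_) _).trans (mul_le_mul_right (hbound n m) _)
  rw [blockSum_mul_coord, norm_mul, Real.norm_of_nonneg hθ0.le, inv_mul_cancel_left₀ hθ0.ne']

theorem BoundedInLp.mono_exponent {Ω : Type*} [MeasurableSpace Ω] {μ : Measure Ω}
    [IsProbabilityMeasure μ] {d : ℕ} {A : ℕ → Ω → EuclideanSpace ℝ (Fin d)} {p p' : ℝ≥0∞}
    (h : BoundedInLp μ A p) (hp : p' ≤ p) : BoundedInLp μ A p' := by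
  obtain ⟨K, hK⟩ := h
  exact ⟨K, fun ℓ => ⟨(hK ℓ).1.mono_exponent hp,
    (eLpNorm_le_eLpNorm_of_exponent_le hp (hK ℓ).1.aestronglyMeasurable).trans (hK ℓ).2⟩⟩

/-- Disposes at once of `p = ∞` and of `q ≤ 2`: on a probability space one may lower `p` and raise
`q`. -/
theorem exists_real_exponents {p q : ℝ≥0∞} (hp : 2 < p) (hqp : q < p) :
    ∃ p' q' : ℝ, 2 < q' ∧ q' < p' ∧ q ≤ ENNReal.ofReal q' ∧ ENNReal.ofReal p' ≤ p := by
  obtain ⟨x, hx1, hx2⟩ := exists_between (max_lt hp hqp)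
  obtain ⟨y, hy1, hy2⟩ := exists_between hx2
  have hx : x ≠ ∞ := hx2.ne_top
  have hy : y ≠ ∞ := hy2.ne_top
  refine ⟨y.toReal, x.toReal, ?_, (ENNReal.toReal_lt_toReal hx hy).2 hy1, ?_, ?_⟩
  · simpa using (ENNReal.toReal_lt_toReal ENNReal.ofNat_ne_top hx).2 ((le_max_left _ _).trans_lt hx1)
  · rw [ENNReal.ofReal_toReal hx]; exact (le_max_right _ _).trans hx1.le
  · rw [ENNReal.ofReal_toReal hy]; exact hy2.le

theorem mainTheorem6 {Ω : Type*} [MeasurableSpace Ω] (μ : Measure Ω) [IsProbabilityMeasure μ]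
    {d : ℕ} (A : ℕ → Ω → EuclideanSpace ℝ (Fin d)) (p : ℝ≥0∞) (hp : 2 < p)
    (hcent : IsCenteredProcess μ A) (hbdd : BoundedInLp μ A p) (hH : ConditionH μ A)
    (q : ℝ≥0∞) (hq0 : 0 < q) (hqp : q < p) :
    ∃ C : ℝ, 0 < C ∧ ∀ m n : ℕ,
      eLpNorm (fun ω => ∑ ℓ ∈ Finset.Ico m (m + n), A ℓ ω) q μ
        ≤ ENNReal.ofReal (C * (n : ℝ) ^ (1 / 2 : ℝ)) := by
  obtain ⟨p', q', hq', hqp', hqq', hpp'⟩ := exists_real_exponents hp hqp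
  have hbdd' := hbdd.mono_exponent hpp'
  choose D hD0 hD using exists_coord_bound hq' hqp' hcent hbdd' hH
  have hDs : 0 ≤ ∑ i, D i := Finset.sum_nonneg fun i _ => (hD0 i).le
  -- The added `1` keeps the constant positive when `d = 0`.
  refine ⟨∑ i, D i + 1, by positivity, fun m n => ?_⟩
  have hmeas : AEStronglyMeasurable (fun ω => ∑ ℓ ∈ Finset.Ico m (m + n), A ℓ ω) μ := by
    obtain ⟨K, hK⟩ := hbdd
    exact Finset.aestronglyMeasurable_fun_sum _ fun ℓ _ => (hK ℓ).1.aestronglyMeasurable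
  have hcoord : ∀ i, AEStronglyMeasurable
      (fun ω => (∑ ℓ ∈ Finset.Ico m (m + n), A ℓ ω) i) μ := fun i =>
    (EuclideanSpace.proj i : EuclideanSpace ℝ (Fin d) →L[ℝ] ℝ).continuous.comp_aestronglyMeasurable
      hmeas
  rw [← Real.sqrt_eq_rpow]
  calc _ ≤ eLpNorm (fun ω => ∑ ℓ ∈ Finset.Ico m (m + n), A ℓ ω) (ENNReal.ofReal q') μ :=
        eLpNorm_le_eLpNorm_of_exponent_le hqq' hmeas
    _ ≤ eLpNorm (∑ i, fun ω => ‖(∑ ℓ ∈ Finset.Ico m (m + n), A ℓ ω) i‖)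
          (ENNReal.ofReal q') μ := by
        refine eLpNorm_mono_real fun ω => ?_
        rw [Finset.sum_apply]
        exact EuclideanSpace.norm_le_sum_abs _
    _ ≤ ∑ i, eLpNorm (fun ω => ‖(∑ ℓ ∈ Finset.Ico m (m + n), A ℓ ω) i‖)
          (ENNReal.ofReal q') μ :=
        eLpNorm_sum_le (fun i _ => (hcoord i).norm) (by rw [ENNReal.one_le_ofReal]; linarith)
    _ ≤ ∑ i, ENNReal.ofReal (D i * √n) := Finset.sum_le_sum fun i _ => by
        rw [eLpNorm_norm]; exact hD i m n
    _ = ENNReal.ofReal ((∑ i, D i) * √n) := by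
        rw [← ENNReal.ofReal_sum_of_nonneg fun i _ => mul_nonneg (hD0 i).le (Real.sqrt_nonneg _),
          Finset.sum_mul]
    _ ≤ _ := by
        apply ENNReal.ofReal_le_ofReal
        gcongr
        linarith
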